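/- Let $k$ be a field and $G$ a group with unit $e$. **Crossed group-cograded Hopf quasigroups.** Let $H=(H_p)_{p\in G}$ be a family of unital, not necessarily associative $k$-algebras, with unital algebra homomorphisms $\Delta_{p,q}:H_{pq}\to H_p\otimes H_q$ (written $h\mapsto h_{(1,p)}\otimes h_{(2,q)}$), which are coassociative, $(\Delta_{p,q}\otimes\mathrm{id})\Delta_{pq,r}=(\mathrm{id}\otimes\Delta_{q,r})\Delta_{p,qr}$, a unital algebra homomorphism $\epsilon:H_e\to k$ with $(\mathrm{id}\otimes\epsilon)\Delta_{p,e}=\mathrm{id}=(\epsilon\otimes\mathrm{id})\Delta_{e,p}$, and unital algebra anti-homomorphisms $S_p:H_p\to H_{p^{-1}}$ such that for all $h\in H_e$, $g\in H_p$ $$S_{p^{-1}}(h_{(1,p^{-1})})(h_{(2,p)}g)=\epsilon(h)g=h_{(1,p)}(S_{p^{-1}}(h_{(2,p^{-1})})g),$$ $$(gh_{(1,p)})S_{p^{-1}}(h_{(2,p^{-1})})=\epsilon(h)g=(gS_{p^{-1}}(h_{(1,p^{-1})}))h_{(2,p)}.$$ Let $\pi$ be a crossing: for all $p,q\in G$ an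 algebra isomorphism $\pi_p:H_q\to H_{pqp^{-1}}$, with $\pi_e=\mathrm{id}$ and $\pi_{pq}=\pi_p\pi_q$, compatible with comultiplication, counit and antipode: $(\pi_p\otimes\pi_p)\Delta_{q,r}=\Delta_{pqp^{-1},prp^{-1}}\pi_p$, $\epsilon\pi_p|_{H_e}=\epsilon$, $\pi_pS_q=S_{pqp^{-1}}\pi_p$. Assume that the antipode is bijective, i.e. every $S_p$ is bijective. **Yetter–Drinfeld modules.** For $p\in G$, a left-right $p$-Yetter–Drinfeld module is a $k$-vector space $V$ with a left $H_p$-module structure ($1\cdot v=v$, $(hg)\cdot v=h\cdot(g\cdot v)$) and linear maps $\rho_r:V\to V\otimes H_r$, $v\mapsto v_{(0)}\otimes v_{(1,r)}$ ($r\in G$), with $(\rho_r\otimes\mathrm{id})\rho_s=(\mathrm{id}\otimes\Delta_{r,s})\rho_{rs}$, $(\mathrm{id}\otimes\epsilon)\rho_e=\mathrm{id}$, and, for all $r\in G$, $v\in V$, $x\in H_{pr}$, $h,g\in H_r$, $$x_{(1,p)}\cdot v_{(0)}\otimes x_{(2,r)}v_{(1,r)}=(x_{(2,p)}\cdot v)_{(0)}\otimes(x_{(2,p)}\cdot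 v)_{(1,r)}\,\pi_{p^{-1}}(x_{(1,prp^{-1})}),$$ $$v_{(0)}\otimes v_{(1,r)}(hg)=v_{(0)}\otimes(v_{(1,r)}h)g,\qquad v_{(0)}\otimes(hv_{(1,r)})g=v_{(0)}\otimes h(v_{(1,r)}g).$$ Morphisms are the $H_p$-linear maps commuting with all $\rho_r$; this is the category $\mathscr{YD}(H)_p$. Let $\mathscr{YD}(H)$ be the disjoint union of the categories $\mathscr{YD}(H)_p$, $p\in G$ (no morphisms between different components). For $V\in\mathscr{YD}(H)_p$ and $W\in\mathscr{YD}(H)_q$ let $V\otimes W\in\mathscr{YD}(H)_{pq}$ be the tensor product over $k$ with $$h\cdot(v\otimes w)=h_{(1,p)}\cdot v\otimes h_{(2,q)}\cdot w,\qquad \rho_r(v\otimes w)=v_{(0)}\otimes w_{(0)}\otimes w_{(1,r)}\pi_{q^{-1}}(v_{(1,qrq^{-1})}),$$ the unit object being $k\in\mathscr{YD}(H)_e$ with $h\cdot c=\epsilon(h)c$ and $\rho_r(c)=c\otimes1$, and the constraints being those of vector spaces. For $s\in G$ let ${}^sV\in\mathscr{YD}(H)_{sps^{-1}}$ be the vector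 space $V$ (with $v$ written ${}^sv$) with $$h\cdot{}^sv={}^s(\pi_{s^{-1}}(h)\cdot v),\qquad \rho_r({}^sv)={}^s(v_{(0)})\otimes\pi_s(v_{(1,s^{-1}rs)}),$$ and $({}^sf)({}^sv)={}^s(f(v))$ for morphisms $f$; put $\phi_s={}^s(\cdot)$. **Theorem.** With these structures $\mathscr{YD}(H)$ is a braided crossed category over $G$: 1. It is a monoidal category; it is the disjoint union of the $\mathscr{YD}(H)_p$, with $\mathscr{YD}(H)_p\otimes\mathscr{YD}(H)_q\subseteq\mathscr{YD}(H)_{pq}$. Every $\phi_s$ is a strict tensor functor, $\phi_e=\mathrm{id}$ and $\phi_{st}=\phi_s\phi_t$ (so $\phi$ is a homomorphism from $G$ to the group of invertible strict tensor functors), and $\phi_s(\mathscr{YD}(H)_p)=\mathscr{YD}(H)_{sps^{-1}}$. 2. For $V\in\mathscr{YD}(H)_p$ and $W\in\mathscr{YD}(H)_q$ put ${}^VW={}^pW$. The formula $$C_{V,W}(v\otimes w)={}^p\big(S_{q^{-1}}(v_{(1,q^{-1})})\cdot w\big)\otimes v_{(0)}$$ defines isomorphisms $C_{V,W}:V\otimes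 W\to{}^VW\otimes V$ in $\mathscr{YD}(H)$ which form a braiding. That is, with $a$ the associativity constraint $(U\otimes V)\otimes W\to U\otimes(V\otimes W)$: for all $f:U\to U'$ in $\mathscr{YD}(H)_p$ and $g:V\to V'$ in $\mathscr{YD}(H)$, $({}^pg\otimes f)\,C_{U,V}=C_{U',V'}\,(f\otimes g)$; for all objects $U,V,W$, $$C_{U\otimes V,W}=a_{{}^{U\otimes V}W,U,V}\,(C_{U,{}^VW}\otimes\mathrm{id}_V)\,a^{-1}_{U,{}^VW,V}\,(\mathrm{id}_U\otimes C_{V,W})\,a_{U,V,W},$$ $$C_{U,V\otimes W}=a^{-1}_{{}^UV,{}^UW,U}\,(\mathrm{id}_{{}^UV}\otimes C_{U,W})\,a_{{}^UV,U,W}\,(C_{U,V}\otimes\mathrm{id}_W)\,a^{-1}_{U,V,W};$$ and $\phi_s(C_{U,V})=C_{\phi_s(U),\phi_s(V)}$ for all $s\in G$. -/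

import Mathlib

open CategoryTheory MonoidalCategory
open scoped TensorProduct

universe u v w

/-! ### Braided crossed categories -/

section

variable {C : Type*} [Category* C] [MonoidalCategory C]

/-- `F` is a strict tensor functor: it preserves the tensor product, the unit object and the
constraints on the nose. -/
structure IsStrictTensor (F : C ⥤ C) : Prop where
  obj_tensor (X Y : C) : F.obj (X ⊗ Y) = F.obj X ⊗ F.obj Y
  obj_unit : F.obj (𝟙_ C) = 𝟙_ C
  map_tensor {X X' Y Y' : C} (f : X ⟶ X') (g : Y ⟶ Y') :
    F.map (f ⊗ₘ g) = eqToHom (obj_tensor X Y) ≫ (F.map f ⊗ₘ F.map g) ≫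
      eqToHom (obj_tensor X' Y').symm
  map_associator (X Y Z : C) :
    F.map (α_ X Y Z).hom = eqToHom (by rw [obj_tensor, obj_tensor]) ≫
      (α_ (F.obj X) (F.obj Y) (F.obj Z)).hom ≫ eqToHom (by rw [obj_tensor, obj_tensor])
  map_leftUnitor (X : C) :
    F.map (λ_ X).hom = eqToHom (by rw [obj_tensor, obj_unit]) ≫ (λ_ (F.obj X)).hom
  map_rightUnitor (X : C) :
    F.map (ρ_ X).hom = eqToHom (by rw [obj_tensor, obj_unit]) ≫ (ρ_ (F.obj X)).hom

variable {G : Type*} [Group G]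

/-- `C` is a crossed category over `G`, with components `C_p = {X | deg X = p}` and conjugations
`φ_s = conj s`. By `conj_one` and `conj_mul`, `φ` is a homomorphism from `G` to the group of
invertible strict tensor functors, and `φ_s(C_p) = C_{sps⁻¹}`. -/
structure IsCrossedCategory (deg : C → G) (conj : G → C ⥤ C) : Prop where
  /-- `C` is the disjoint union of its components -/
  deg_eq {X Y : C} (f : X ⟶ Y) : deg X = deg Y
  deg_tensor (X Y : C) : deg (X ⊗ Y) = deg X * deg Y
  conj_strict (s : G) : IsStrictTensor (conj s)
  conj_one : conj 1 = 𝟭 C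
  conj_mul (s t : G) : conj (s * t) = conj t ⋙ conj s
  deg_conj (s : G) (X : C) : deg ((conj s).obj X) = s * deg X * s⁻¹

namespace IsCrossedCategory

variable {deg : C → G} {conj : G → C ⥤ C}

theorem conj_mul_obj (hC : IsCrossedCategory deg conj) (s t : G) (X : C) :
    (conj s).obj ((conj t).obj X) = (conj (s * t)).obj X := by
  rw [hC.conj_mul]; rfl

theorem naturality_eq (hC : IsCrossedCategory deg conj) {U U' V' : C} (f : U ⟶ U') :
    (conj (deg U)).obj V' ⊗ U' = (conj (deg U')).obj V' ⊗ U' := by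
  rw [hC.deg_eq f]

theorem tensor_left_eq (hC : IsCrossedCategory deg conj) (U V W : C) :
    (conj (deg U)).obj ((conj (deg V)).obj W) ⊗ (U ⊗ V) =
      (conj (deg (U ⊗ V))).obj W ⊗ (U ⊗ V) := by
  rw [hC.deg_tensor, hC.conj_mul_obj]

theorem tensor_right_eq (hC : IsCrossedCategory deg conj) (U V W : C) :
    ((conj (deg U)).obj V ⊗ (conj (deg U)).obj W) ⊗ U = (conj (deg U)).obj (V ⊗ W) ⊗ U := by
  rw [(hC.conj_strict _).obj_tensor]

theorem conj_braiding_eq (hC : IsCrossedCategory deg conj) (s : G) (U V : C) :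
    (conj (deg ((conj s).obj U))).obj ((conj s).obj V) ⊗ (conj s).obj U =
      (conj s).obj ((conj (deg U)).obj V ⊗ U) := by
  rw [(hC.conj_strict _).obj_tensor, hC.conj_mul_obj, hC.conj_mul_obj, hC.deg_conj,
    inv_mul_cancel_right]

end IsCrossedCategory

/-- The isomorphisms `c_{U,V} : U ⊗ V → ᵁV ⊗ U`, where `ᵁV = φ_{deg U}(V)`, form a braiding of the
crossed category `C`. -/
structure IsCrossedBraiding {deg : C → G} {conj : G → C ⥤ C} (hC : IsCrossedCategory deg conj)
    (c : ∀ U V : C, U ⊗ V ≅ (conj (deg U)).obj V ⊗ U) : Prop where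
  naturality {U U' V V' : C} (f : U ⟶ U') (g : V ⟶ V') :
    (c U V).hom ≫ ((conj (deg U)).map g ⊗ₘ f) ≫ eqToHom (hC.naturality_eq f) =
      (f ⊗ₘ g) ≫ (c U' V').hom
  tensor_left (U V W : C) :
    (c (U ⊗ V) W).hom =
      (α_ U V W).hom ≫ U ◁ (c V W).hom ≫ (α_ U ((conj (deg V)).obj W) V).inv ≫
        (c U ((conj (deg V)).obj W)).hom ▷ V ≫
          (α_ ((conj (deg U)).obj ((conj (deg V)).obj W)) U V).hom ≫
            eqToHom (hC.tensor_left_eq U V W)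
  tensor_right (U V W : C) :
    (c U (V ⊗ W)).hom =
      (α_ U V W).inv ≫ (c U V).hom ▷ W ≫ (α_ ((conj (deg U)).obj V) U W).hom ≫
        (conj (deg U)).obj V ◁ (c U W).hom ≫
          (α_ ((conj (deg U)).obj V) ((conj (deg U)).obj W) U).inv ≫
            eqToHom (hC.tensor_right_eq U V W)
  conj_map (s : G) (U V : C) :
    (conj s).map (c U V).hom =
      eqToHom ((hC.conj_strict s).obj_tensor U V) ≫
        (c ((conj s).obj U) ((conj s).obj V)).hom ≫ eqToHom (hC.conj_braiding_eq s U V)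

end

/-! ### Group-cograded Hopf quasigroups -/

/-- A `G`-cograded Hopf quasigroup over `k`: a family of unital, not necessarily associative
`k`-algebras `H_p` (`p ∈ G`), with comultiplications `Δ_{p,q} : H_{pq} → H_p ⊗ H_q`, a counit
`ε : H_e → k` and antipodes `S_p : H_p → H_{p⁻¹}`.

To avoid transports along equalities in `G`, a structure map whose source or target is indexed by a
product or an inverse takes that index as a variable together with an equation which determines it:
`comul h` for `h : p * q = r` is `Δ_{p,q} : H_r = H_{pq} → H_p ⊗ H_q`, and `antipode h` for
`h : p * q = 1` is `S_p : H_p → H_q = H_{p⁻¹}`. -/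
structure GroupCogradedHopfQuasigroup (k : Type u) [Field k] (G : Type v) [Group G] where
  /-- the components `H_p` -/
  obj : G → Type w
  [ring : ∀ p, NonAssocRing (obj p)]
  [module : ∀ p, Module k (obj p)]
  [isScalarTower : ∀ p, IsScalarTower k (obj p) (obj p)]
  [smulCommClass : ∀ p, SMulCommClass k (obj p) (obj p)]
  /-- the comultiplication `Δ_{p,q}` -/
  comul {p q r : G} (h : p * q = r) : obj r →ₗ[k] obj p ⊗[k] obj q
  /-- the counit `ε` -/
  counit : obj 1 →ₗ[k] k
  /-- the antipode `S_p` -/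
  antipode {p q : G} (h : p * q = 1) : obj p →ₗ[k] obj q
  comul_mul {p q r : G} (h : p * q = r) (x y : obj r) :
    comul h (x * y) = comul h x * comul h y
  comul_one {p q r : G} (h : p * q = r) : comul h 1 = 1
  counit_mul (x y : obj 1) : counit (x * y) = counit x * counit y
  counit_one : counit 1 = 1
  /-- `(Δ_{p,q} ⊗ id) Δ_{pq,r} = (id ⊗ Δ_{q,r}) Δ_{p,qr}` -/
  coassoc {p q r pq qr t : G} (h₁ : p * q = pq) (h₂ : pq * r = t) (h₃ : q * r = qr)
    (h₄ : p * qr = t) (x : obj t) :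
    TensorProduct.assoc k (obj p) (obj q) (obj r) ((comul h₁).rTensor (obj r) (comul h₂ x)) =
      (comul h₃).lTensor (obj p) (comul h₄ x)
  /-- `(id ⊗ ε) Δ_{p,e} = id` -/
  lTensor_counit_comul {p : G} (x : obj p) :
    TensorProduct.rid k (obj p) (counit.lTensor (obj p) (comul (mul_one p) x)) = x
  /-- `(ε ⊗ id) Δ_{e,p} = id` -/
  rTensor_counit_comul {p : G} (x : obj p) :
    TensorProduct.lid k (obj p) (counit.rTensor (obj p) (comul (one_mul p) x)) = x
  antipode_mul {p q : G} (h : p * q = 1) (x y : obj p) :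
    antipode h (x * y) = antipode h y * antipode h x
  antipode_one {p q : G} (h : p * q = 1) : antipode h 1 = 1
  /-- `S(x₍₁₎) (x₍₂₎ g) = ε(x) g` for `x ∈ H_e`, `g ∈ H_p` (with `q = p⁻¹`) -/
  antipode_mul_mul {p q : G} (h : q * p = 1) (x : obj 1) (g : obj p) :
    LinearMap.mul' k (obj p)
      (TensorProduct.map (antipode h) (LinearMap.mulRight k g) (comul h x)) = counit x • g
  /-- `x₍₁₎ (S(x₍₂₎) g) = ε(x) g` -/
  mul_antipode_mul {p q : G} (h : q * p = 1) (h' : p * q = 1) (x : obj 1) (g : obj p) :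
    LinearMap.mul' k (obj p)
      (TensorProduct.map LinearMap.id (LinearMap.mulRight k g ∘ₗ antipode h) (comul h' x)) =
      counit x • g
  /-- `(g x₍₁₎) S(x₍₂₎) = g ε(x)` -/
  mul_mul_antipode {p q : G} (h : q * p = 1) (h' : p * q = 1) (x : obj 1) (g : obj p) :
    LinearMap.mul' k (obj p)
      (TensorProduct.map (LinearMap.mulLeft k g) (antipode h) (comul h' x)) = counit x • g
  /-- `(g S(x₍₁₎)) x₍₂₎ = g ε(x)` -/
  mul_antipode_mul' {p q : G} (h : q * p = 1) (x : obj 1) (g : obj p) :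
    LinearMap.mul' k (obj p)
      (TensorProduct.map (LinearMap.mulLeft k g ∘ₗ antipode h) LinearMap.id (comul h x)) =
      counit x • g

attribute [instance] GroupCogradedHopfQuasigroup.ring GroupCogradedHopfQuasigroup.module
  GroupCogradedHopfQuasigroup.isScalarTower GroupCogradedHopfQuasigroup.smulCommClass

/-- A crossed group-cograded Hopf quasigroup: the crossing `π : G → Aut(H)` is an action of `G` by
algebra automorphisms with `π_p(H_q) = H_{pqp⁻¹}` which preserve the comultiplication, the counit
and the antipode. `crossing p h` for `h : p * q * p⁻¹ = r` is `π_p : H_q → H_r = H_{pqp⁻¹}`; it is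
bijective by `crossing_one` and `crossing_crossing`. -/
structure CrossedHopfQuasigroup (k : Type u) [Field k] (G : Type v) [Group G] extends
    GroupCogradedHopfQuasigroup.{u, v, w} k G where
  /-- the crossing `π_p` -/
  crossing (p : G) {q r : G} (h : p * q * p⁻¹ = r) : obj q →ₗ[k] obj r
  crossing_map_mul (p : G) {q r : G} (h : p * q * p⁻¹ = r) (x y : obj q) :
    crossing p h (x * y) = crossing p h x * crossing p h y
  crossing_map_one (p : G) {q r : G} (h : p * q * p⁻¹ = r) : crossing p h 1 = 1
  counit_crossing (p : G) (h : p * 1 * p⁻¹ = 1) (x : obj 1) :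
    counit (crossing p h x) = counit x
  crossing_antipode (p : G) {q q' r r' : G} (h : p * q * p⁻¹ = r) (h' : p * q' * p⁻¹ = r')
    (hq : q * q' = 1) (hr : r * r' = 1) (x : obj q) :
    crossing p h' (antipode hq x) = antipode hr (crossing p h x)
  crossing_comul (p : G) {q r t q' r' t' : G} (hq : p * q * p⁻¹ = q') (hr : p * r * p⁻¹ = r')
    (ht : p * t * p⁻¹ = t') (h : q * r = t) (h' : q' * r' = t') (x : obj t) :
    TensorProduct.map (crossing p hq) (crossing p hr) (comul h x) = comul h' (crossing p ht x)
  crossing_one {q : G} (h : 1 * q * 1⁻¹ = q) (x : obj q) : crossing 1 h x = x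
  /-- `π_p π_q = π_{pq}` -/
  crossing_crossing (p q : G) {r s t : G} (h₁ : q * r * q⁻¹ = s) (h₂ : p * s * p⁻¹ = t)
    (h₃ : p * q * r * (p * q)⁻¹ = t) (x : obj r) :
    crossing p h₂ (crossing q h₁ x) = crossing (p * q) h₃ x

section

variable {k : Type u} [Field k] {G : Type v} [Group G]

/-- The antipode is bijective: every `S_p : H_p → H_{p⁻¹}` is a bijection. -/
def GroupCogradedHopfQuasigroup.BijectiveAntipode
    (H : GroupCogradedHopfQuasigroup.{u, v, w} k G) : Prop :=
  ∀ (p q : G) (h : p * q = 1), Function.Bijective (H.antipode h)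

/-- Transport between equal components. -/
def GroupCogradedHopfQuasigroup.castObj (H : GroupCogradedHopfQuasigroup.{u, v, w} k G)
    {p q : G} (h : p = q) (x : H.obj p) : H.obj q := h ▸ x

namespace CrossedHopfQuasigroup

variable (H : CrossedHopfQuasigroup.{u, v, w} k G)

/-- `b ⊗ c ↦ c ⋅ π_s(b)`, for `b ∈ H_q` and `c ∈ H_r` with `r = sqs⁻¹`. -/
noncomputable def mulCrossing (s : G) {q r : G} (h : s * q * s⁻¹ = r) :
    H.obj q ⊗[k] H.obj r →ₗ[k] H.obj r :=
  TensorProduct.lift ((LinearMap.mul k (H.obj r)).flip ∘ₗ H.crossing s h)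

end CrossedHopfQuasigroup

/-! ### Yetter-Drinfeld modules -/

/-- Left-right `p`-Yetter-Drinfeld modules over `H`: a left `H_p`-module `V` with coactions
`ρ_r : V → V ⊗ H_r`, `v ↦ v₍₀₎ ⊗ v₍₁,ᵣ₎`, for `r ∈ G`. -/
structure YDModule (H : CrossedHopfQuasigroup.{u, v, w} k G) (p : G) where
  /-- the underlying vector space -/
  carrier : Type u
  [addCommGroup : AddCommGroup carrier]
  [module : Module k carrier]
  /-- the action `x ⋅ v = act x v` of `H_p` -/
  act : H.obj p →ₗ[k] carrier →ₗ[k] carrier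
  act_one : act 1 = LinearMap.id
  act_mul (x y : H.obj p) : act (x * y) = act x ∘ₗ act y
  /-- the coaction `ρ_r` -/
  coact (r : G) : carrier →ₗ[k] carrier ⊗[k] H.obj r
  /-- `(ρ_r ⊗ id) ρ_s = (id ⊗ Δ_{r,s}) ρ_{rs}` -/
  coassoc {r s t : G} (h : r * s = t) (a : carrier) :
    TensorProduct.assoc k carrier (H.obj r) (H.obj s)
      ((coact r).rTensor (H.obj s) (coact s a)) = (H.comul h).lTensor carrier (coact t a)
  /-- `(id ⊗ ε) ρ_e = id` -/
  lTensor_counit_coact (a : carrier) :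
    TensorProduct.rid k carrier (H.counit.lTensor carrier (coact 1 a)) = a
  /-- `x₍₁,ₚ₎ ⋅ v₍₀₎ ⊗ x₍₂,ᵣ₎ v₍₁,ᵣ₎ = (x₍₂,ₚ₎ ⋅ v)₍₀₎ ⊗ (x₍₂,ₚ₎ ⋅ v)₍₁,ᵣ₎ π_{p⁻¹}(x₍₁,ᵣ'₎)` for all
  `x ∈ H_{pr}`, where `r' = prp⁻¹` -/
  crossed {r r' t : G} (h : p * r = t) (h' : r' * p = t) (hr : p⁻¹ * r' * p⁻¹⁻¹ = r)
    (x : H.obj t) (a : carrier) :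
    TensorProduct.map₂ act (LinearMap.mul k (H.obj r)) (H.comul h x) (coact r a) =
      TensorProduct.lift
        (LinearMap.lTensorHom carrier ∘ₗ (LinearMap.mul k (H.obj r)).flip ∘ₗ H.crossing p⁻¹ hr)
        ((coact r ∘ₗ act.flip a).lTensor (H.obj r') (H.comul h' x))
  /-- `v₍₀₎ ⊗ v₍₁,ᵣ₎ (x y) = v₍₀₎ ⊗ (v₍₁,ᵣ₎ x) y` -/
  coact_mul_mul {r : G} (x y : H.obj r) (a : carrier) :
    (LinearMap.mulRight k (x * y)).lTensor carrier (coact r a) =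
      (LinearMap.mulRight k y ∘ₗ LinearMap.mulRight k x).lTensor carrier (coact r a)
  /-- `v₍₀₎ ⊗ (x v₍₁,ᵣ₎) y = v₍₀₎ ⊗ x (v₍₁,ᵣ₎ y)` -/
  mul_coact_mul {r : G} (x y : H.obj r) (a : carrier) :
    (LinearMap.mulRight k y ∘ₗ LinearMap.mulLeft k x).lTensor carrier (coact r a) =
      (LinearMap.mulLeft k x ∘ₗ LinearMap.mulRight k y).lTensor carrier (coact r a)

attribute [instance] YDModule.addCommGroup YDModule.module

namespace YDModule

variable {H : CrossedHopfQuasigroup.{u, v, w} k G} {p q : G}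

/-- `(v ⊗ b) ⊗ (w ⊗ c) ↦ (v ⊗ w) ⊗ c π_s(b)`. -/
noncomputable def coactMul (V : Type u) (W : Type u) [AddCommGroup V] [Module k V]
    [AddCommGroup W] [Module k W] (s : G) {r' r : G} (h : s * r' * s⁻¹ = r) :
    (V ⊗[k] H.obj r') ⊗[k] (W ⊗[k] H.obj r) →ₗ[k] (V ⊗[k] W) ⊗[k] H.obj r :=
  (H.mulCrossing s h).lTensor (V ⊗[k] W) ∘ₗ
    (TensorProduct.tensorTensorTensorComm k V (H.obj r') W (H.obj r)).toLinearMap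

@[simp]
theorem coactMul_tmul (V : Type u) (W : Type u) [AddCommGroup V] [Module k V]
    [AddCommGroup W] [Module k W] (s : G) {r' r : G} (h : s * r' * s⁻¹ = r) (a : V) (b : W)
    (x : H.obj r') (y : H.obj r) :
    coactMul V W s h ((a ⊗ₜ x) ⊗ₜ (b ⊗ₜ y)) = (a ⊗ₜ b) ⊗ₜ (y * H.crossing s h x) := by
  simp [coactMul, CrossedHopfQuasigroup.mulCrossing]

theorem conj_index (q r : G) : q⁻¹ * (q * r * q⁻¹) * q⁻¹⁻¹ = r := by group

/-- The action `x ⋅ (a ⊗ b) = x₍₁,ₚ₎ ⋅ a ⊗ x₍₂,q₎ ⋅ b` of `H_{pq}` on `V ⊗ W`. -/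
noncomputable def tensorAct (V : YDModule H p) (W : YDModule H q) :
    H.obj (p * q) →ₗ[k] (V.carrier ⊗[k] W.carrier) →ₗ[k] (V.carrier ⊗[k] W.carrier) :=
  TensorProduct.map₂ V.act W.act ∘ₗ H.comul rfl

/-- The coaction `ρ_r(a ⊗ b) = a₍₀₎ ⊗ b₍₀₎ ⊗ b₍₁,ᵣ₎ π_{q⁻¹}(a₍₁,ᵣ'₎)`, `r' = qrq⁻¹`, on `V ⊗ W`. -/
noncomputable def tensorCoact (V : YDModule H p) (W : YDModule H q) (r : G) :
    V.carrier ⊗[k] W.carrier →ₗ[k] (V.carrier ⊗[k] W.carrier) ⊗[k] H.obj r :=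
  coactMul V.carrier W.carrier q⁻¹ (conj_index q r) ∘ₗ
    TensorProduct.map (V.coact (q * r * q⁻¹)) (W.coact r)

theorem map₂_mul {A B M N : Type*} [NonAssocRing A] [Module k A] [IsScalarTower k A A]
    [SMulCommClass k A A] [NonAssocRing B] [Module k B] [IsScalarTower k B B]
    [SMulCommClass k B B] [AddCommGroup M] [Module k M] [AddCommGroup N] [Module k N]
    (f : A →ₗ[k] M →ₗ[k] M) (g : B →ₗ[k] N →ₗ[k] N)
    (hf : ∀ x y, f (x * y) = f x ∘ₗ f y) (hg : ∀ x y, g (x * y) = g x ∘ₗ g y)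
    (x y : A ⊗[k] B) :
    TensorProduct.map₂ f g (x * y) = TensorProduct.map₂ f g x ∘ₗ TensorProduct.map₂ f g y := by
  induction x with
  | zero => simp
  | add x₁ x₂ h₁ h₂ => simp [add_mul, h₁, h₂, LinearMap.add_comp]
  | tmul a b =>
    induction y with
    | zero => simp
    | add x₁ x₂ h₁ h₂ => simp [mul_add, h₁, h₂, LinearMap.comp_add]
    | tmul c d =>
      ext m n
      simp [hf, hg]

section coactMul

variable (W : YDModule H q) {V : Type u} [AddCommGroup V] [Module k V] (s : G) {r' r : G}
  (h : s * r' * s⁻¹ = r)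

theorem coactMul_tmul_left (a : V) (x : H.obj r') (B : W.carrier ⊗[k] H.obj r) :
    coactMul V W.carrier s h ((a ⊗ₜ x) ⊗ₜ B) =
      TensorProduct.map (TensorProduct.mk k V W.carrier a)
        (LinearMap.mulRight k (H.crossing s h x)) B := by
  induction B with
  | zero => simp
  | add x y hx hy => simp only [TensorProduct.tmul_add, map_add, hx, hy]
  | tmul => simp

theorem coactMul_mulLeft (A : V ⊗[k] H.obj r') (b : W.carrier) (d : H.obj r) :
    coactMul V W.carrier s h (A ⊗ₜ (LinearMap.mulLeft k d).lTensor _ (W.coact r b)) =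
      (LinearMap.mulLeft k d).lTensor _ (coactMul V W.carrier s h (A ⊗ₜ W.coact r b)) := by
  induction A with
  | zero => simp
  | add x y hx hy => simp only [TensorProduct.add_tmul, map_add, hx, hy]
  | tmul a x =>
    have := congrArg (TensorProduct.map (TensorProduct.mk k V W.carrier a) LinearMap.id)
      (W.mul_coact_mul d (H.crossing s h x) b)
    rw [coactMul_tmul_left, coactMul_tmul_left]
    simpa only [LinearMap.lTensor, TensorProduct.map_map,
      LinearMap.comp_id, LinearMap.id_comp, LinearMap.comp_assoc] using this

theorem coactMul_mulRight_right (A : V ⊗[k] H.obj r') (b : W.carrier) (y : H.obj r') :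
    coactMul V W.carrier s h
        (A ⊗ₜ (LinearMap.mulRight k (H.crossing s h y)).lTensor _ (W.coact r b)) =
      coactMul V W.carrier s h ((LinearMap.mulLeft k y).lTensor _ A ⊗ₜ W.coact r b) := by
  induction A with
  | zero => simp
  | add x y hx hy => simp only [TensorProduct.add_tmul, map_add, hx, hy]
  | tmul a x =>
    have := congrArg (TensorProduct.map (TensorProduct.mk k V W.carrier a) LinearMap.id)
      (W.coact_mul_mul (H.crossing s h y) (H.crossing s h x) b)
    rw [LinearMap.lTensor_tmul, coactMul_tmul_left, coactMul_tmul_left, LinearMap.mulLeft_apply,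
      H.crossing_map_mul]
    simpa only [LinearMap.lTensor, TensorProduct.map_map,
      LinearMap.comp_id, LinearMap.id_comp, LinearMap.comp_assoc] using this.symm

theorem coactMul_mulRight_left (A : V ⊗[k] H.obj r') (b : W.carrier) (y : H.obj r') :
    coactMul V W.carrier s h ((LinearMap.mulRight k y).lTensor _ A ⊗ₜ W.coact r b) =
      (LinearMap.mulRight k (H.crossing s h y)).lTensor _
        (coactMul V W.carrier s h (A ⊗ₜ W.coact r b)) := by
  induction A with
  | zero => simp
  | add x y hx hy => simp only [TensorProduct.add_tmul, map_add, hx, hy]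
  | tmul a x =>
    have := congrArg (TensorProduct.map (TensorProduct.mk k V W.carrier a) LinearMap.id)
      (W.coact_mul_mul (H.crossing s h x) (H.crossing s h y) b)
    rw [LinearMap.lTensor_tmul, coactMul_tmul_left, coactMul_tmul_left, LinearMap.mulRight_apply,
      H.crossing_map_mul]
    simpa only [LinearMap.lTensor, TensorProduct.map_map,
      LinearMap.comp_id, LinearMap.id_comp, LinearMap.comp_assoc] using this

end coactMul

theorem tensorCoact_tmul (V : YDModule H p) (W : YDModule H q) {r r' : G}
    (h : q⁻¹ * r' * q⁻¹⁻¹ = r) (a : V.carrier) (b : W.carrier) :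
    tensorCoact V W r (a ⊗ₜ b) =
      coactMul V.carrier W.carrier q⁻¹ h (V.coact r' a ⊗ₜ W.coact r b) := by
  obtain rfl : r' = q * r * q⁻¹ := by rw [← h]; group
  rfl

theorem tensor_coassoc (V : YDModule H p) (W : YDModule H q) {r s t : G} (h : r * s = t)
    (c : V.carrier ⊗[k] W.carrier) :
    TensorProduct.assoc k _ (H.obj r) (H.obj s)
      ((tensorCoact V W r).rTensor (H.obj s) (tensorCoact V W s c)) =
        (H.comul h).lTensor _ (tensorCoact V W t c) := by
  induction c with
  | zero => simp
  | add c d hc hd => simp only [map_add, hc, hd]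
  | tmul a b =>
  have h' : (q * r * q⁻¹) * (q * s * q⁻¹) = q * t * q⁻¹ := by rw [← h]; group
  let N : (V.carrier ⊗[k] (H.obj (q * r * q⁻¹) ⊗[k] H.obj (q * s * q⁻¹))) ⊗[k]
      (W.carrier ⊗[k] (H.obj r ⊗[k] H.obj s)) →ₗ[k]
      (V.carrier ⊗[k] W.carrier) ⊗[k] (H.obj r ⊗[k] H.obj s) :=
    (TensorProduct.lift ((LinearMap.mul k (H.obj r ⊗[k] H.obj s)).flip ∘ₗ
      TensorProduct.map (H.crossing q⁻¹ (conj_index q r)) (H.crossing q⁻¹ (conj_index q s)))).lTensor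
        (V.carrier ⊗[k] W.carrier) ∘ₗ
    (TensorProduct.tensorTensorTensorComm k _ _ _ _).toLinearMap
  have N_tmul : ∀ a x b y, N ((a ⊗ₜ x) ⊗ₜ (b ⊗ₜ y)) = (a ⊗ₜ b) ⊗ₜ (y * TensorProduct.map
      (H.crossing q⁻¹ (conj_index q r)) (H.crossing q⁻¹ (conj_index q s)) x) := by
    intros; simp [N]
  have key₁ : ∀ A B, TensorProduct.assoc k _ (H.obj r) (H.obj s)
      ((tensorCoact V W r).rTensor (H.obj s)
        (coactMul V.carrier W.carrier q⁻¹ (conj_index q s) (A ⊗ₜ B))) =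
      N (TensorProduct.assoc k _ _ _ ((V.coact _).rTensor _ A) ⊗ₜ
        TensorProduct.assoc k _ _ _ ((W.coact r).rTensor _ B)) := by
    intro A B
    induction A with
    | zero => simp
    | add x y hx hy => simp only [TensorProduct.add_tmul, map_add, hx, hy]
    | tmul a x =>
    induction B with
    | zero => simp
    | add x y hx hy => simp only [TensorProduct.tmul_add, map_add, hx, hy]
    | tmul b y =>
    rw [coactMul_tmul, LinearMap.rTensor_tmul, LinearMap.rTensor_tmul, LinearMap.rTensor_tmul,
      tensorCoact_tmul V W (conj_index q r)]
    generalize V.coact (q * r * q⁻¹) a = A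
    generalize W.coact r b = B
    induction A with
    | zero => simp
    | add x y hx hy => simp only [TensorProduct.add_tmul, map_add, hx, hy]
    | tmul a x =>
    induction B with
    | zero => simp
    | add x y hx hy => simp only [TensorProduct.tmul_add, TensorProduct.add_tmul, map_add, hx, hy]
    | tmul b y =>
    simp [N_tmul]
  have key₂ : ∀ A B, N ((H.comul h').lTensor _ A ⊗ₜ (H.comul h).lTensor _ B) =
      (H.comul h).lTensor _ (coactMul V.carrier W.carrier q⁻¹ (conj_index q t) (A ⊗ₜ B)) := by
    intro A B
    induction A with
    | zero => simp
    | add x y hx hy => simp only [TensorProduct.add_tmul, map_add, hx, hy]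
    | tmul a x =>
    induction B with
    | zero => simp
    | add x y hx hy => simp only [TensorProduct.tmul_add, map_add, hx, hy]
    | tmul b y =>
    rw [coactMul_tmul, LinearMap.lTensor_tmul, LinearMap.lTensor_tmul, LinearMap.lTensor_tmul,
      N_tmul, H.comul_mul, H.crossing_comul q⁻¹ _ _ (conj_index q t) h' h]
  rw [tensorCoact_tmul V W (conj_index q s), key₁, V.coassoc h', W.coassoc h, key₂,
    tensorCoact_tmul V W (conj_index q t)]

theorem tensor_crossed (V : YDModule H p) (W : YDModule H q)
    {r r' t : G} (h : p * q * r = t) (h' : r' * (p * q) = t)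
    (hr : (p * q)⁻¹ * r' * (p * q)⁻¹⁻¹ = r) (x : H.obj t) (c : V.carrier ⊗[k] W.carrier) :
    TensorProduct.map₂ (tensorAct V W) (LinearMap.mul k (H.obj r)) (H.comul h x)
        (tensorCoact V W r c) =
      TensorProduct.lift
        (LinearMap.lTensorHom _ ∘ₗ (LinearMap.mul k (H.obj r)).flip ∘ₗ H.crossing (p * q)⁻¹ hr)
        ((tensorCoact V W r ∘ₗ (tensorAct V W).flip c).lTensor (H.obj r') (H.comul h' x)) := by
  induction c with
  | zero => simp
  | add c d hc hd =>
    simp only [map_add, hc, hd, LinearMap.comp_add, LinearMap.lTensor_add, LinearMap.add_apply]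
  | tmul a b =>
  obtain ⟨r₁, hr₁⟩ : ∃ r₁, r₁ = q * r * q⁻¹ := ⟨_, rfl⟩
  have e₁ : q⁻¹ * r₁ * q⁻¹⁻¹ = r := hr₁ ▸ conj_index q r
  have e₂ : p⁻¹ * r' * p⁻¹⁻¹ = r₁ := by rw [hr₁, ← hr]; group
  have i₁ : p * (q * r) = t := by rw [← h]; group
  have i₂ : r₁ * q = q * r := by rw [hr₁]; group
  have i₃ : p * r₁ * q = t := by rw [hr₁, ← h]; group
  have i₄ : r' * p = p * r₁ := by rw [hr₁, ← hr]; group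
  have tc : ∀ a b, tensorCoact V W r (a ⊗ₜ b) =
      coactMul V.carrier W.carrier q⁻¹ e₁ (V.coact r₁ a ⊗ₜ W.coact r b) :=
    tensorCoact_tmul V W e₁
  -- the linear operators used at the successive stages
  let f := (LinearMap.rTensorHom (H.obj r₁)).flip (V.coact r₁ a) ∘ₗ V.act
  let g := (TensorProduct.map₂ W.act (LinearMap.mul k (H.obj r))).flip (W.coact r b)
  let g' := TensorProduct.lift
        (LinearMap.lTensorHom _ ∘ₗ (LinearMap.mul k (H.obj r)).flip ∘ₗ H.crossing q⁻¹ e₁) ∘ₗ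
        ((W.coact r ∘ₗ W.act.flip b).lTensor (H.obj r₁))
  let f₂ := (TensorProduct.map₂ V.act (LinearMap.mul k (H.obj r₁))).flip (V.coact r₁ a)
  let g₂ := W.coact r ∘ₗ W.act.flip b
  let f₃ := TensorProduct.lift
        (LinearMap.lTensorHom _ ∘ₗ (LinearMap.mul k (H.obj r₁)).flip ∘ₗ H.crossing p⁻¹ e₂) ∘ₗ
        ((V.coact r₁ ∘ₗ V.act.flip a).lTensor (H.obj r'))
  have step₁ : ∀ X : H.obj (p * q) ⊗[k] H.obj r,
      TensorProduct.map₂ (tensorAct V W) (LinearMap.mul k (H.obj r)) X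
        (tensorCoact V W r (a ⊗ₜ b)) =
      coactMul V.carrier W.carrier q⁻¹ e₁ (TensorProduct.map f g
        (TensorProduct.assoc k _ _ _ ((H.comul rfl).rTensor _ X))) := by
    intro X
    induction X with
    | zero => simp
    | add x y hx hy => simp only [map_add, LinearMap.add_apply, hx, hy]
    | tmul z d =>
    rw [LinearMap.rTensor_tmul, tc]
    have : TensorProduct.map₂ (tensorAct V W) (LinearMap.mul k (H.obj r)) (z ⊗ₜ d) =
        (TensorProduct.map₂ V.act W.act (H.comul rfl z)).rTensor _ ∘ₗ
          (LinearMap.mulLeft k d).lTensor _ := by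
      ext; simp [tensorAct]
    rw [this, LinearMap.comp_apply, ← coactMul_mulLeft]
    generalize H.comul rfl z = Z
    induction Z with
    | zero => simp
    | add x y hx hy =>
      simp only [TensorProduct.add_tmul, map_add, LinearMap.rTensor_add, LinearMap.add_apply, hx, hy]
    | tmul y z =>
    simp only [TensorProduct.assoc_tmul, TensorProduct.map_tmul, f, g, LinearMap.comp_apply,
      LinearMap.flip_apply, LinearMap.coe_rTensorHom]
    generalize V.coact r₁ a = A
    generalize W.coact r b = B
    induction A with
    | zero => simp
    | add x y hx hy => simp only [TensorProduct.add_tmul, map_add, hx, hy]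
    | tmul a x =>
    induction B with
    | zero => simp
    | add x y hx hy => simp only [TensorProduct.tmul_add, map_add, hx, hy]
    | tmul b y => simp
  have gg : g ∘ₗ H.comul rfl = g' ∘ₗ H.comul i₂ := by
    ext y; exact W.crossed rfl i₂ e₁ y b
  have ff : f₂ ∘ₗ H.comul rfl = f₃ ∘ₗ H.comul i₄ := by
    ext y; exact V.crossed rfl i₄ e₂ y a
  have step₃ : ∀ U, coactMul V.carrier W.carrier q⁻¹ e₁ (TensorProduct.map f g' U) =
      coactMul V.carrier W.carrier q⁻¹ e₁ (TensorProduct.map f₂ g₂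
        ((TensorProduct.assoc k _ _ _).symm U)) := by
    intro U
    induction U with
    | zero => simp
    | add x y hx hy => simp only [map_add, hx, hy]
    | tmul d Y =>
    induction Y with
    | zero => simp
    | add x y hx hy => simp only [TensorProduct.tmul_add, map_add, hx, hy]
    | tmul y z =>
    have := coactMul_mulRight_right W q⁻¹ e₁ (f d) (W.act z b) y
    simp only [TensorProduct.map_tmul, TensorProduct.assoc_symm_tmul]
    have h₁ : g' (y ⊗ₜ z) = (LinearMap.mulRight k (H.crossing q⁻¹ e₁ y)).lTensor _
        (W.coact r (W.act z b)) := by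
      simp only [g', LinearMap.comp_apply, LinearMap.lTensor_tmul, TensorProduct.lift.tmul,
        LinearMap.flip_apply]
      congr 1
    have h₂ : f₂ (d ⊗ₜ y) = (LinearMap.mulLeft k y).lTensor _ (f d) := by
      simp only [f, f₂, LinearMap.comp_apply, LinearMap.flip_apply]
      generalize V.coact r₁ a = A
      induction A with
      | zero => simp
      | add x y hx hy => simp only [map_add, hx, hy]
      | tmul => simp
    rw [h₁, h₂, this]
    rfl
  have step₅ : ∀ U, coactMul V.carrier W.carrier q⁻¹ e₁ (TensorProduct.map f₃ g₂ U) =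
      TensorProduct.lift
        (LinearMap.lTensorHom _ ∘ₗ (LinearMap.mul k (H.obj r)).flip ∘ₗ H.crossing (p * q)⁻¹ hr)
        ((coactMul V.carrier W.carrier q⁻¹ e₁ ∘ₗ
          TensorProduct.map (V.coact r₁ ∘ₗ V.act.flip a) g₂).lTensor (H.obj r')
            (TensorProduct.assoc k _ _ _ U)) := by
    intro U
    induction U with
    | zero => simp
    | add x y hx hy => simp only [map_add, hx, hy]
    | tmul Y z =>
    induction Y with
    | zero => simp
    | add x y hx hy => simp only [TensorProduct.add_tmul, map_add, hx, hy]
    | tmul y d =>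
    have := coactMul_mulRight_left W q⁻¹ e₁ (V.coact r₁ (V.act d a)) (W.act z b)
      (H.crossing p⁻¹ e₂ y)
    have h₃ : H.crossing q⁻¹ e₁ (H.crossing p⁻¹ e₂ y) = H.crossing (p * q)⁻¹ hr y := by
      have e : q⁻¹ * p⁻¹ = (p * q)⁻¹ := by group
      have : ∀ (s : G) (e : q⁻¹ * p⁻¹ = s) (hs : s * r' * s⁻¹ = r),
          H.crossing q⁻¹ e₁ (H.crossing p⁻¹ e₂ y) = H.crossing s hs y := by
        intro s e hs
        subst e
        exact H.crossing_crossing _ _ _ _ _ _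
      exact this _ e hr
    rw [h₃] at this
    exact this
  rw [step₁, H.coassoc rfl h rfl i₁]
  rw [LinearMap.map_lTensor, gg, ← LinearMap.map_lTensor, step₃, ← H.coassoc rfl i₃ i₂ i₁,
    LinearEquiv.symm_apply_apply, LinearMap.map_rTensor, ff, ← LinearMap.map_rTensor, step₅,
    H.coassoc i₄ i₃ rfl h', ← LinearMap.lTensor_comp_apply]
  congr 3
  ext y
  simp only [LinearMap.comp_apply, LinearMap.flip_apply, tensorAct, g₂]
  generalize H.comul rfl y = Y
  induction Y with
  | zero => simp
  | add x y hx hy => simp only [map_add, LinearMap.add_apply, hx, hy]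
  | tmul y z =>
    simp only [TensorProduct.map_tmul, TensorProduct.map₂_apply_tmul, tc]
    rfl

theorem coactMul_coact_mulRight (V : YDModule H p) {W : Type u} [AddCommGroup W] [Module k W]
    (s : G) {r' r : G} (h : s * r' * s⁻¹ = r) (h' : s⁻¹ * r * s⁻¹⁻¹ = r') (a : V.carrier)
    (B : W ⊗[k] H.obj r) (y : H.obj r') :
    coactMul V.carrier W s h ((LinearMap.mulRight k y).lTensor _ (V.coact r' a) ⊗ₜ B) =
      (LinearMap.mulRight k (H.crossing s h y)).lTensor _
        (coactMul V.carrier W s h (V.coact r' a ⊗ₜ B)) := by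
  induction B with
  | zero => simp
  | add x y hx hy => simp only [TensorProduct.tmul_add, map_add, hx, hy]
  | tmul b x =>
    obtain ⟨x, rfl⟩ : ∃ x', H.crossing s h x' = x :=
      ⟨H.crossing s⁻¹ h' x, by
        rw [H.crossing_crossing s s⁻¹ h' h (by group)]
        have : ∀ (t : G) (e : s * s⁻¹ = t) (ht : t * r * t⁻¹ = r) , t = 1 →
            H.crossing t ht x = x := by
          rintro t e ht rfl
          exact H.crossing_one _ _
        exact this _ rfl _ (mul_inv_cancel s)⟩
    have key : ∀ A : V.carrier ⊗[k] H.obj r',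
        coactMul V.carrier W s h (A ⊗ₜ (b ⊗ₜ H.crossing s h x)) =
          TensorProduct.map ((TensorProduct.mk k V.carrier W).flip b) (H.crossing s h)
            ((LinearMap.mulLeft k x).lTensor _ A) := by
      intro A
      induction A with
      | zero => simp
      | add x y hx hy => simp only [TensorProduct.add_tmul, map_add, hx, hy]
      | tmul => simp [H.crossing_map_mul]
    have key₂ : ∀ A : V.carrier ⊗[k] H.obj r',
        TensorProduct.map ((TensorProduct.mk k V.carrier W).flip b) (H.crossing s h)
            ((LinearMap.mulRight k y).lTensor _ A) =
          (LinearMap.mulRight k (H.crossing s h y)).lTensor _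
            (TensorProduct.map ((TensorProduct.mk k V.carrier W).flip b) (H.crossing s h) A) := by
      intro A
      induction A with
      | zero => simp
      | add x y hx hy => simp only [map_add, hx, hy]
      | tmul => simp [H.crossing_map_mul]
    rw [key, key, ← key₂, ← LinearMap.lTensor_comp_apply, ← LinearMap.lTensor_comp_apply,
      V.mul_coact_mul]

theorem crossing_comp {s t z : G} (hz : s * t = z) {r r' r'' : G} (h₁ : t * r * t⁻¹ = r')
    (h₂ : s * r' * s⁻¹ = r'') (h₃ : z * r * z⁻¹ = r'') (x : H.obj r) :
    H.crossing s h₂ (H.crossing t h₁ x) = H.crossing z h₃ x := by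
  subst hz
  exact H.crossing_crossing s t h₁ h₂ h₃ x

theorem crossing_inv {s r r' : G} (h₁ : s⁻¹ * r * s⁻¹⁻¹ = r') (h₂ : s * r' * s⁻¹ = r)
    (x : H.obj r) : H.crossing s h₂ (H.crossing s⁻¹ h₁ x) = x := by
  rw [crossing_comp (mul_inv_cancel s) h₁ h₂ (by group), H.crossing_one]

theorem tensor_coact_mul_mul (V : YDModule H p) (W : YDModule H q) {r : G} (x y : H.obj r)
    (c : V.carrier ⊗[k] W.carrier) :
    (LinearMap.mulRight k (x * y)).lTensor _ (tensorCoact V W r c) =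
      (LinearMap.mulRight k y ∘ₗ LinearMap.mulRight k x).lTensor _ (tensorCoact V W r c) := by
  induction c with
  | zero => simp
  | add c d hc hd => simp only [map_add, hc, hd]
  | tmul a b =>
  have h₁ := conj_index q r
  have h₂ : q⁻¹⁻¹ * r * q⁻¹⁻¹⁻¹ = q * r * q⁻¹ := by group
  obtain ⟨x, rfl⟩ : ∃ x', H.crossing q⁻¹ h₁ x' = x := ⟨_, crossing_inv h₂ h₁ x⟩
  obtain ⟨y, rfl⟩ : ∃ y', H.crossing q⁻¹ h₁ y' = y := ⟨_, crossing_inv h₂ h₁ y⟩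
  rw [tensorCoact_tmul V W h₁, ← H.crossing_map_mul, ← coactMul_mulRight_left, V.coact_mul_mul,
    LinearMap.lTensor_comp_apply, LinearMap.lTensor_comp_apply, coactMul_mulRight_left,
    coactMul_mulRight_left]

theorem tensor_mul_coact_mul (V : YDModule H p) (W : YDModule H q) {r : G} (x y : H.obj r)
    (c : V.carrier ⊗[k] W.carrier) :
    (LinearMap.mulRight k y ∘ₗ LinearMap.mulLeft k x).lTensor _ (tensorCoact V W r c) =
      (LinearMap.mulLeft k x ∘ₗ LinearMap.mulRight k y).lTensor _ (tensorCoact V W r c) := by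
  induction c with
  | zero => simp
  | add c d hc hd => simp only [map_add, hc, hd]
  | tmul a b =>
  have h₁ := conj_index q r
  have h₂ : q⁻¹⁻¹ * r * q⁻¹⁻¹⁻¹ = q * r * q⁻¹ := by group
  obtain ⟨y, rfl⟩ : ∃ y', H.crossing q⁻¹ h₁ y' = y := ⟨_, crossing_inv h₂ h₁ y⟩
  rw [tensorCoact_tmul V W h₁, LinearMap.lTensor_comp_apply, LinearMap.lTensor_comp_apply,
    ← coactMul_mulLeft, ← coactMul_mulRight_left, ← coactMul_mulLeft,
    ← coactMul_coact_mulRight V _ h₁ h₂]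

theorem tensor_lTensor_counit_coact (V : YDModule H p) (W : YDModule H q)
    (c : V.carrier ⊗[k] W.carrier) :
    TensorProduct.rid k _ (H.counit.lTensor _ (tensorCoact V W 1 c)) = c := by
  induction c with
  | zero => simp
  | add c d hc hd => simp only [map_add, hc, hd]
  | tmul a b =>
  have h : q⁻¹ * 1 * q⁻¹⁻¹ = 1 := by group
  have key : ∀ A B, TensorProduct.rid k _ (H.counit.lTensor _
      (coactMul V.carrier W.carrier q⁻¹ h (A ⊗ₜ B))) =
      TensorProduct.rid k _ (H.counit.lTensor _ A) ⊗ₜ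
        TensorProduct.rid k _ (H.counit.lTensor _ B) := by
    intro A B
    induction A with
    | zero => simp
    | add x y hx hy => simp only [TensorProduct.add_tmul, map_add, hx, hy]
    | tmul a x =>
    induction B with
    | zero => simp
    | add x y hx hy => simp only [TensorProduct.tmul_add, map_add, hx, hy]
    | tmul b y =>
      simp [H.counit_mul, H.counit_crossing, TensorProduct.smul_tmul', TensorProduct.tmul_smul,
        smul_smul]
  rw [tensorCoact_tmul V W h, key, V.lTensor_counit_coact, W.lTensor_counit_coact]

/-- The tensor product of a `p`- and a `q`-Yetter-Drinfeld module, a `pq`-Yetter-Drinfeld module. -/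
noncomputable abbrev tensor (V : YDModule H p) (W : YDModule H q) : YDModule H (p * q) where
  carrier := V.carrier ⊗[k] W.carrier
  act := tensorAct V W
  act_one := by
    ext a b
    simp [tensorAct, H.comul_one, Algebra.TensorProduct.one_def, V.act_one, W.act_one]
  act_mul x y := by
    simp only [tensorAct, LinearMap.comp_apply, H.comul_mul]
    exact map₂_mul _ _ V.act_mul W.act_mul _ _
  coact := tensorCoact V W
  coassoc h := tensor_coassoc V W h
  lTensor_counit_coact := tensor_lTensor_counit_coact V W
  crossed h h' hr x c := tensor_crossed V W h h' hr x c
  coact_mul_mul := tensor_coact_mul_mul V W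
  mul_coact_mul := tensor_mul_coact_mul V W

/-- The unit object: `k` with `x ⋅ c = ε(x) c` for `x ∈ H_e`, and `ρ_r(c) = c ⊗ 1`. -/
noncomputable abbrev unit (H : CrossedHopfQuasigroup.{u, v, w} k G) : YDModule H 1 where
  carrier := k
  act := LinearMap.lsmul k k ∘ₗ H.counit
  act_one := by ext; simp [H.counit_one]
  act_mul x y := by ext; simp [H.counit_mul]
  coact r := (TensorProduct.mk k k (H.obj r)).flip 1
  coassoc h a := by
    simp [H.comul_one, Algebra.TensorProduct.one_def]
  lTensor_counit_coact a := by simp [H.counit_one]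
  crossed {r r' t} h h' hr x a := by
    obtain rfl : r = t := by rw [← h, one_mul]
    obtain rfl : r' = r := by rw [← h', mul_one]
    have h₁ : ∀ X, TensorProduct.map₂ (LinearMap.lsmul k k ∘ₗ H.counit)
        (LinearMap.mul k (H.obj r')) X ((TensorProduct.mk k k (H.obj r')).flip 1 a) =
        a ⊗ₜ TensorProduct.lid k _ (H.counit.rTensor _ X) := by
      intro X
      induction X with
      | zero => simp
      | add x y hx hy => simp only [map_add, LinearMap.add_apply, hx, hy, TensorProduct.tmul_add]
      | tmul x y => simp [TensorProduct.smul_tmul', TensorProduct.tmul_smul, mul_comm]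
    have h₂ : ∀ X, TensorProduct.lift
        (LinearMap.lTensorHom k ∘ₗ (LinearMap.mul k (H.obj r')).flip ∘ₗ H.crossing 1⁻¹ hr)
        (((TensorProduct.mk k k (H.obj r')).flip 1 ∘ₗ
          (LinearMap.lsmul k k ∘ₗ H.counit).flip a).lTensor (H.obj r') X) =
        a ⊗ₜ TensorProduct.rid k _ (H.counit.lTensor _ X) := by
      intro X
      induction X with
      | zero => simp
      | add x y hx hy => simp only [map_add, hx, hy, TensorProduct.tmul_add]
      | tmul x y =>
        simp [H.crossing_one, TensorProduct.smul_tmul', TensorProduct.tmul_smul, mul_comm]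
    rw [h₁, h₂, H.lTensor_counit_comul, H.rTensor_counit_comul]
  coact_mul_mul x y a := by simp
  mul_coact_mul x y a := by simp

theorem conj_index' (s r : G) : s * (s⁻¹ * r * s) * s⁻¹ = r := by group

/-- The coaction `ρ_r(a) = a₍₀₎ ⊗ π_s(a₍₁,ᵣ'₎)`, `r' = s⁻¹rs`, on `ˢV`. -/
noncomputable def conjCoact (s : G) (V : YDModule H p) (r : G) :
    V.carrier →ₗ[k] V.carrier ⊗[k] H.obj r :=
  (H.crossing s (conj_index' s r)).lTensor V.carrier ∘ₗ V.coact (s⁻¹ * r * s)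

theorem conjCoact_apply (s : G) (V : YDModule H p) {r r' : G} (h : s * r' * s⁻¹ = r)
    (a : V.carrier) :
    conjCoact s V r a = (H.crossing s h).lTensor V.carrier (V.coact r' a) := by
  obtain rfl : r' = s⁻¹ * r * s := by rw [← h]; group
  rfl

/-- The `sps⁻¹`-Yetter-Drinfeld module `ˢV` of a `p`-Yetter-Drinfeld module `V`: the same vector
space with the action `x ⋅ ˢa = ˢ(π_{s⁻¹}(x) ⋅ a)`. -/
noncomputable abbrev conj (s : G) (V : YDModule H p) : YDModule H (s * p * s⁻¹) where
  carrier := V.carrier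
  act := V.act ∘ₗ H.crossing s⁻¹ (conj_index s p)
  act_one := by simp [H.crossing_map_one, V.act_one]
  act_mul x y := by simp [H.crossing_map_mul, V.act_mul]
  coact := conjCoact s V
  coassoc {r z t} h a := by
    have hr := conj_index' s r
    have hz := conj_index' s z
    have ht := conj_index' s t
    have h' : (s⁻¹ * r * s) * (s⁻¹ * z * s) = s⁻¹ * t * s := by rw [← h]; group
    rw [conjCoact_apply s V hz, conjCoact_apply s V ht, ← LinearMap.lTensor_comp_apply]
    have e₁ : H.comul h ∘ₗ H.crossing s ht =
        TensorProduct.map (H.crossing s hr) (H.crossing s hz) ∘ₗ H.comul h' := by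
      ext x
      exact (H.crossing_comul s hr hz ht h' h x).symm
    rw [e₁, LinearMap.lTensor_comp_apply, ← V.coassoc h']
    generalize V.coact (s⁻¹ * z * s) a = A
    induction A with
    | zero => simp
    | add x y hx hy => simp only [map_add, hx, hy]
    | tmul a x =>
      simp only [LinearMap.lTensor_tmul, LinearMap.rTensor_tmul, conjCoact_apply s V hr]
      generalize V.coact (s⁻¹ * r * s) a = A
      induction A with
      | zero => simp
      | add x y hx hy => simp only [TensorProduct.add_tmul, map_add, hx, hy]
      | tmul a x => simp
  lTensor_counit_coact a := by
    have h : s * 1 * s⁻¹ = 1 := by group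
    have : H.counit ∘ₗ H.crossing s h = H.counit := by ext x; exact H.counit_crossing s h x
    rw [conjCoact_apply s V h, ← LinearMap.lTensor_comp_apply, this, V.lTensor_counit_coact]
  crossed {r r' t} h h' hr x a := by
    have hr₀ := conj_index' s r
    have ht₀ : s⁻¹ * t * s⁻¹⁻¹ = s⁻¹ * t * s := by group
    have hr₁ : s⁻¹ * r * s⁻¹⁻¹ = s⁻¹ * r * s := by group
    have hr₂ : s⁻¹ * r' * s⁻¹⁻¹ = s⁻¹ * r' * s := by group
    have i₁ : p * (s⁻¹ * r * s) = s⁻¹ * t * s := by rw [← h]; group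
    have i₂ : (s⁻¹ * r' * s) * p = s⁻¹ * t * s := by rw [← h']; group
    have i₃ : p⁻¹ * (s⁻¹ * r' * s) * p⁻¹⁻¹ = s⁻¹ * r * s := by rw [← hr]; group
    have k₁ : ∀ X A, TensorProduct.map₂ (V.act ∘ₗ H.crossing s⁻¹ (conj_index s p))
        (LinearMap.mul k (H.obj r)) X ((H.crossing s hr₀).lTensor V.carrier A) =
        (H.crossing s hr₀).lTensor V.carrier (TensorProduct.map₂ V.act (LinearMap.mul k _)
          (TensorProduct.map (H.crossing s⁻¹ (conj_index s p)) (H.crossing s⁻¹ hr₁) X) A) := by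
      intro X A
      induction X with
      | zero => simp
      | add x y hx hy => simp only [map_add, LinearMap.add_apply, hx, hy]
      | tmul x y =>
      induction A with
      | zero => simp
      | add x y hx hy => simp only [map_add, hx, hy]
      | tmul a z => simp [H.crossing_map_mul, crossing_inv]
    have k₂ : ∀ X, TensorProduct.lift (LinearMap.lTensorHom V.carrier ∘ₗ
          (LinearMap.mul k (H.obj r)).flip ∘ₗ H.crossing (s * p * s⁻¹)⁻¹ hr)
        ((conjCoact s V r ∘ₗ (V.act ∘ₗ H.crossing s⁻¹ (conj_index s p)).flip a).lTensor
          (H.obj r') X) =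
        (H.crossing s hr₀).lTensor V.carrier (TensorProduct.lift (LinearMap.lTensorHom V.carrier ∘ₗ
          (LinearMap.mul k _).flip ∘ₗ H.crossing p⁻¹ i₃)
          ((V.coact _ ∘ₗ V.act.flip a).lTensor _
            (TensorProduct.map (H.crossing s⁻¹ hr₂) (H.crossing s⁻¹ (conj_index s p)) X))) := by
      intro X
      induction X with
      | zero => simp
      | add x y hx hy => simp only [map_add, hx, hy]
      | tmul x y =>
      have e : H.crossing (s * p * s⁻¹)⁻¹ hr x =
          H.crossing s hr₀ (H.crossing p⁻¹ i₃ (H.crossing s⁻¹ hr₂ x)) := by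
        rw [crossing_comp (z := p⁻¹ * s⁻¹) rfl hr₂ i₃ (by rw [← hr]; group),
          crossing_comp (z := (s * p * s⁻¹)⁻¹) (by group)]
      simp only [LinearMap.lTensor_tmul, TensorProduct.map_tmul, LinearMap.comp_apply,
        TensorProduct.lift.tmul, LinearMap.flip_apply, conjCoact_apply s V hr₀, e,
        LinearMap.coe_lTensorHom]
      generalize V.coact _ _ = A
      induction A with
      | zero => simp
      | add x y hx hy => simp only [map_add, hx, hy]
      | tmul a z => simp [H.crossing_map_mul]
    rw [conjCoact_apply s V hr₀, k₁, k₂, H.crossing_comul s⁻¹ _ hr₁ ht₀ h i₁,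
      H.crossing_comul s⁻¹ hr₂ _ ht₀ h' i₂, V.crossed i₁ i₂ i₃]
  coact_mul_mul {r} x y a := by
    have h₁ := conj_index' s r
    have h₂ : s⁻¹ * r * s⁻¹⁻¹ = s⁻¹ * r * s := by group
    have k₁ : ∀ y, LinearMap.mulRight k y ∘ₗ H.crossing s h₁ =
        H.crossing s h₁ ∘ₗ LinearMap.mulRight k (H.crossing s⁻¹ h₂ y) := by
      intro y; ext z; simp [H.crossing_map_mul, crossing_inv]
    rw [conjCoact_apply s V h₁, ← LinearMap.lTensor_comp_apply, ← LinearMap.lTensor_comp_apply, k₁,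
      LinearMap.comp_assoc, k₁, ← LinearMap.comp_assoc, k₁, LinearMap.comp_assoc,
      LinearMap.lTensor_comp_apply, LinearMap.lTensor_comp_apply, H.crossing_map_mul,
      V.coact_mul_mul]
  mul_coact_mul {r} x y a := by
    have h₁ := conj_index' s r
    have h₂ : s⁻¹ * r * s⁻¹⁻¹ = s⁻¹ * r * s := by group
    have k₁ : ∀ y, LinearMap.mulRight k y ∘ₗ H.crossing s h₁ =
        H.crossing s h₁ ∘ₗ LinearMap.mulRight k (H.crossing s⁻¹ h₂ y) := by
      intro y; ext z; simp [H.crossing_map_mul, crossing_inv]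
    have k₂ : ∀ y, LinearMap.mulLeft k y ∘ₗ H.crossing s h₁ =
        H.crossing s h₁ ∘ₗ LinearMap.mulLeft k (H.crossing s⁻¹ h₂ y) := by
      intro y; ext z; simp [H.crossing_map_mul, crossing_inv]
    rw [conjCoact_apply s V h₁, ← LinearMap.lTensor_comp_apply, ← LinearMap.lTensor_comp_apply,
      LinearMap.comp_assoc, k₂, ← LinearMap.comp_assoc, k₁, LinearMap.comp_assoc,
      LinearMap.comp_assoc, k₁,
      ← LinearMap.comp_assoc _ (H.crossing s h₁) (LinearMap.mulLeft k x), k₂]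
    simp only [LinearMap.comp_assoc]
    rw [LinearMap.lTensor_comp_apply, LinearMap.lTensor_comp_apply _ (H.crossing s h₁),
      V.mul_coact_mul]

/-! ### The category of `p`-Yetter-Drinfeld modules -/

/-- Morphisms of `p`-Yetter-Drinfeld modules: the `H_p`-linear maps that commute with all `ρ_r`. -/
@[ext]
structure Hom (V W : YDModule H p) where
  /-- the underlying linear map -/
  toLin : V.carrier →ₗ[k] W.carrier
  map_act (x : H.obj p) (a : V.carrier) : toLin (V.act x a) = W.act x (toLin a)
  map_coact (r : G) (a : V.carrier) :
    W.coact r (toLin a) = toLin.rTensor (H.obj r) (V.coact r a)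

instance : Category (YDModule H p) where
  Hom := Hom
  id V := ⟨LinearMap.id, fun _ _ => rfl, fun r a => by simp⟩
  comp f g := ⟨g.toLin ∘ₗ f.toLin, fun x a => by simp [f.map_act, g.map_act], fun r a => by
    simp [g.map_coact, f.map_coact, LinearMap.rTensor_comp_apply]⟩

end YDModule

/-! ### The disjoint union of these categories -/

/-- The disjoint union of the categories of `p`-Yetter-Drinfeld modules, `p ∈ G`. Its objects are
the pairs `⟨p, V⟩`, and there are no morphisms between objects of different degrees. -/
abbrev YD (H : CrossedHopfQuasigroup.{u, v, w} k G) := Σ p : G, YDModule H p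

namespace YD

variable {H : CrossedHopfQuasigroup.{u, v, w} k G}

/-- The degree: `deg ⟨p, V⟩ = p`. -/
abbrev deg (X : YD H) : G := X.1

theorem deg_eq : ∀ {X Y : YD H}, (X ⟶ Y) → X.deg = Y.deg
  | _, _, Sigma.SigmaHom.mk _ => rfl

/-- The linear map underlying a morphism. -/
def toLin : ∀ {X Y : YD H}, (X ⟶ Y) → (X.2.carrier →ₗ[k] Y.2.carrier)
  | _, _, Sigma.SigmaHom.mk f => YDModule.Hom.toLin f

theorem toLin_act {X Y : YD H} (f : X ⟶ Y) (x : H.obj X.1) (a : X.2.carrier) :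
    toLin f (X.2.act x a) = Y.2.act (H.castObj (deg_eq f) x) (toLin f a) := by
  obtain ⟨f⟩ := f
  exact YDModule.Hom.map_act f x a

theorem toLin_coact {X Y : YD H} (f : X ⟶ Y) (r : G) (a : X.2.carrier) :
    Y.2.coact r (toLin f a) = (toLin f).rTensor (H.obj r) (X.2.coact r a) := by
  obtain ⟨f⟩ := f
  exact YDModule.Hom.map_coact f r a

@[simp]
theorem toLin_id (X : YD H) : toLin (𝟙 X) = LinearMap.id := rfl

@[simp]
theorem toLin_comp {X Y Z : YD H} (f : X ⟶ Y) (g : Y ⟶ Z) :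
    toLin (f ≫ g) = toLin g ∘ₗ toLin f := by
  obtain ⟨f⟩ := f
  obtain ⟨g⟩ := g
  rfl

theorem hom_ext {X Y : YD H} {f g : X ⟶ Y} (h : toLin f = toLin g) : f = g := by
  obtain ⟨f⟩ := f
  obtain ⟨g⟩ := g
  exact congrArg _ (YDModule.Hom.ext h)

/-- The morphism with a given underlying linear map, between objects whose degrees are equal. -/
def mkHom {X Y : YD H} (h : X.deg = Y.deg) (f : X.2.carrier →ₗ[k] Y.2.carrier)
    (h₁ : ∀ (x : H.obj X.1) (a : X.2.carrier),
      f (X.2.act x a) = Y.2.act (H.castObj h x) (f a))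
    (h₂ : ∀ (r : G) (a : X.2.carrier),
      Y.2.coact r (f a) = f.rTensor (H.obj r) (X.2.coact r a)) : X ⟶ Y := by
  obtain ⟨p, V⟩ := X
  obtain ⟨q, W⟩ := Y
  change p = q at h
  subst h
  exact Sigma.SigmaHom.mk ⟨f, h₁, h₂⟩

@[simp]
theorem toLin_mkHom {X Y : YD H} (h : X.deg = Y.deg) (f : X.2.carrier →ₗ[k] Y.2.carrier) (h₁ h₂) :
    toLin (mkHom h f h₁ h₂) = f := by
  obtain ⟨p, V⟩ := X
  obtain ⟨q, W⟩ := Y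
  change p = q at h
  subst h
  rfl

/-- The isomorphism with given mutually inverse underlying linear maps. -/
def mkIso {X Y : YD H} (h : X.deg = Y.deg) (f : X.2.carrier ≃ₗ[k] Y.2.carrier)
    (h₁ : ∀ (x : H.obj X.1) (a : X.2.carrier),
      f (X.2.act x a) = Y.2.act (H.castObj h x) (f a))
    (h₂ : ∀ (r : G) (a : X.2.carrier),
      Y.2.coact r (f a) = f.toLinearMap.rTensor (H.obj r) (X.2.coact r a)) : X ≅ Y where
  hom := mkHom h f.toLinearMap h₁ h₂
  inv := mkHom h.symm f.symm.toLinearMap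
    (fun x a => by
      obtain ⟨p, V⟩ := X
      obtain ⟨q, W⟩ := Y
      obtain rfl : p = q := h
      apply f.injective
      have := h₁ x (f.symm a)
      simp only [LinearEquiv.apply_symm_apply, LinearEquiv.coe_coe] at this ⊢
      exact this.symm)
    (fun r a => by
      have h₃ := h₂ r (f.symm a)
      simp only [LinearEquiv.apply_symm_apply] at h₃
      rw [h₃, ← LinearMap.rTensor_comp_apply]
      simp)
  hom_inv_id := hom_ext (by ext; simp)
  inv_hom_id := hom_ext (by ext; simp)

@[simp]
theorem toLin_mkIso_hom {X Y : YD H} (h : X.deg = Y.deg) (f : X.2.carrier ≃ₗ[k] Y.2.carrier)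
    (h₁ h₂) : toLin (mkIso h f h₁ h₂).hom = f.toLinearMap :=
  toLin_mkHom h _ _ _

@[simp]
theorem toLin_mkIso_inv {X Y : YD H} (h : X.deg = Y.deg) (f : X.2.carrier ≃ₗ[k] Y.2.carrier)
    (h₁ h₂) : toLin (mkIso h f h₁ h₂).inv = f.symm.toLinearMap :=
  toLin_mkHom h.symm _ _ _

/-! #### The tensor product -/

theorem comul_castObj {p q r t : G} (h : p * q = t) (e : r = t) (x : H.obj r) :
    H.comul h (H.castObj e x) = H.comul (h.trans e.symm) x := by
  subst e; rfl

/-- `X ⊗ Y`. -/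
noncomputable abbrev tensorObj (X Y : YD H) : YD H := ⟨X.1 * Y.1, X.2.tensor Y.2⟩

/-- `f ⊗ g`. -/
noncomputable def tensorHom {X X' Y Y' : YD H} (f : X ⟶ X') (g : Y ⟶ Y') :
    tensorObj X Y ⟶ tensorObj X' Y' :=
  mkHom (congrArg₂ (· * ·) (deg_eq f) (deg_eq g)) (TensorProduct.map (toLin f) (toLin g))
    (by
      obtain ⟨f⟩ := f
      obtain ⟨g⟩ := g
      intro x (c : _ ⊗[k] _)
      change TensorProduct.map _ _ (TensorProduct.map₂ _ _ (H.comul rfl x) c) =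
        TensorProduct.map₂ _ _ (H.comul rfl x) (TensorProduct.map _ _ c)
      generalize H.comul rfl x = X
      induction X with
      | zero => simp
      | add x y hx hy => simp only [map_add, LinearMap.add_apply, hx, hy]
      | tmul x y =>
      induction c with
      | zero => simp
      | add x y hx hy => simp only [map_add, hx, hy]
      | tmul a b =>
        simp only [TensorProduct.map₂_apply_tmul, TensorProduct.map_tmul]
        exact congrArg₂ _ (YDModule.Hom.map_act f x a) (YDModule.Hom.map_act g y b))
    (by
      obtain ⟨f⟩ := f
      obtain ⟨g⟩ := g
      intro r (c : _ ⊗[k] _)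
      induction c with
      | zero => simp
      | add x y hx hy => simp only [map_add, hx, hy]
      | tmul a b =>
      rw [TensorProduct.map_tmul, YDModule.tensorCoact_tmul _ _ (YDModule.conj_index _ r),
        YDModule.tensorCoact_tmul _ _ (YDModule.conj_index _ r)]
      simp only [toLin]
      rw [YDModule.Hom.map_coact f, YDModule.Hom.map_coact g]
      generalize YDModule.coact _ _ a = A
      generalize YDModule.coact _ _ b = B
      induction A with
      | zero => simp
      | add x y hx hy => simp only [map_add, TensorProduct.add_tmul, hx, hy]
      | tmul a x =>
      induction B with
      | zero => simp
      | add x y hx hy => simp only [map_add, TensorProduct.tmul_add, hx, hy]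
      | tmul b y => simp)

@[simp]
theorem toLin_tensorHom {X X' Y Y' : YD H} (f : X ⟶ X') (g : Y ⟶ Y') :
    toLin (tensorHom f g) = TensorProduct.map (toLin f) (toLin g) := toLin_mkHom ..

/-- The associativity constraint `(a ⊗ b) ⊗ c ↦ a ⊗ (b ⊗ c)`. -/
noncomputable def associator (X Y Z : YD H) :
    tensorObj (tensorObj X Y) Z ≅ tensorObj X (tensorObj Y Z) :=
  mkIso (mul_assoc _ _ _) (TensorProduct.assoc k X.2.carrier Y.2.carrier Z.2.carrier)
    (by
      obtain ⟨p, U⟩ := X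
      obtain ⟨q, V⟩ := Y
      obtain ⟨r, W⟩ := Z
      intro x (c : (U.carrier ⊗[k] V.carrier) ⊗[k] W.carrier)
      change TensorProduct.assoc k _ _ _ (TensorProduct.map₂
        (TensorProduct.map₂ U.act V.act ∘ₗ H.comul rfl) W.act (H.comul rfl x) c) =
        TensorProduct.map₂ U.act (TensorProduct.map₂ V.act W.act ∘ₗ H.comul rfl)
          (H.comul rfl (H.castObj _ x)) (TensorProduct.assoc k _ _ _ c)
      have k₁ : ∀ X : H.obj (p * q) ⊗[k] H.obj r,
          TensorProduct.map₂ (TensorProduct.map₂ U.act V.act ∘ₗ H.comul rfl) W.act X =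
          TensorProduct.map₂ (TensorProduct.map₂ U.act V.act) W.act
            ((H.comul rfl).rTensor _ X) := by
        intro X
        induction X with
        | zero => simp
        | add x y hx hy => simp only [map_add, hx, hy]
        | tmul => ext; simp
      have k₂ : ∀ X : H.obj p ⊗[k] H.obj (q * r),
          TensorProduct.map₂ U.act (TensorProduct.map₂ V.act W.act ∘ₗ H.comul rfl) X =
          TensorProduct.map₂ U.act (TensorProduct.map₂ V.act W.act)
            ((H.comul rfl).lTensor _ X) := by
        intro X
        induction X with
        | zero => simp
        | add x y hx hy => simp only [map_add, hx, hy]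
        | tmul => ext; simp
      rw [k₁, k₂, comul_castObj, ← H.coassoc rfl rfl rfl]
      suffices key : ∀ X : (H.obj p ⊗[k] H.obj q) ⊗[k] H.obj r, TensorProduct.assoc k _ _ _
          (TensorProduct.map₂ (TensorProduct.map₂ U.act V.act) W.act X c) =
          TensorProduct.map₂ U.act (TensorProduct.map₂ V.act W.act)
            (TensorProduct.assoc k _ _ _ X) (TensorProduct.assoc k _ _ _ c) from key _
      intro X
      induction X with
      | zero => simp
      | add x y hx hy => simp only [map_add, LinearMap.add_apply, hx, hy]
      | tmul x z =>
      induction x with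
      | zero => simp
      | add x y hx hy => simp only [map_add, LinearMap.add_apply, TensorProduct.add_tmul, hx, hy]
      | tmul x y =>
      induction c with
      | zero => simp
      | add x y hx hy => simp only [map_add, hx, hy]
      | tmul a c =>
      induction a with
      | zero => simp
      | add x y hx hy => simp only [map_add, TensorProduct.add_tmul, hx, hy]
      | tmul a b => simp)
    (by
      obtain ⟨p, U⟩ := X
      obtain ⟨q, V⟩ := Y
      obtain ⟨r, W⟩ := Z
      intro t (c : (U.carrier ⊗[k] V.carrier) ⊗[k] W.carrier)
      have i₁ := YDModule.conj_index r t
      have i₂ := YDModule.conj_index q (r * t * r⁻¹)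
      have i₃ : (q * r)⁻¹ * (q * (r * t * r⁻¹) * q⁻¹) * (q * r)⁻¹⁻¹ = t := by group
      induction c with
      | zero => simp
      | add x y hx hy => simp only [map_add, hx, hy]
      | tmul c d =>
      induction c with
      | zero => simp
      | add x y hx hy => simp only [map_add, TensorProduct.add_tmul, hx, hy]
      | tmul a b =>
      rw [TensorProduct.assoc_tmul, YDModule.tensorCoact_tmul U (V.tensor W) i₃,
        YDModule.tensorCoact_tmul (U.tensor V) W i₁, YDModule.tensorCoact_tmul U V i₂,
        YDModule.tensorCoact_tmul V W i₁]
      generalize U.coact _ a = A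
      generalize V.coact _ b = B
      induction A with
      | zero => simp
      | add x y hx hy => simp only [map_add, TensorProduct.add_tmul, hx, hy]
      | tmul a x =>
      induction B with
      | zero => simp
      | add x y hx hy => simp only [map_add, TensorProduct.tmul_add, TensorProduct.add_tmul, hx, hy]
      | tmul b y =>
      rw [YDModule.coactMul_tmul, YDModule.coactMul_tmul_left, YDModule.coactMul_tmul_left,
        YDModule.coactMul_tmul_left,
        H.crossing_map_mul,
        YDModule.crossing_comp (z := (q * r)⁻¹) (by group) i₂ i₁ i₃]
      have := W.coact_mul_mul (H.crossing r⁻¹ i₁ y) (H.crossing (q * r)⁻¹ i₃ x) d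
      have k₁ : ∀ (D : W.carrier ⊗[k] H.obj t) (z : H.obj t),
          ((TensorProduct.assoc k U.carrier V.carrier W.carrier).toLinearMap.rTensor (H.obj t))
            (TensorProduct.map (TensorProduct.mk k _ W.carrier (a ⊗ₜ b))
              (LinearMap.mulRight k z) D) =
          TensorProduct.map (TensorProduct.mk k U.carrier _ a ∘ₗ TensorProduct.mk k _ _ b)
            LinearMap.id ((LinearMap.mulRight k z).lTensor _ D) := by
        intro D z
        induction D with
        | zero => simp
        | add x y hx hy => simp only [map_add, hx, hy]
        | tmul => simp
      rw [k₁, this]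
      generalize W.coact _ d = D
      induction D with
      | zero => simp
      | add x y hx hy => simp only [map_add, hx, hy]
      | tmul => simp)

/-- The left unit constraint `c ⊗ a ↦ c a`. -/
noncomputable def leftUnitor (X : YD H) : tensorObj ⟨1, YDModule.unit H⟩ X ≅ X :=
  mkIso (one_mul _) (TensorProduct.lid k X.2.carrier)
    (by
      obtain ⟨p, V⟩ := X
      intro x (c : k ⊗[k] V.carrier)
      change TensorProduct.lid k _ (TensorProduct.map₂ (LinearMap.lsmul k k ∘ₗ H.counit) V.act
        (H.comul rfl x) c) = V.act (H.castObj _ x) (TensorProduct.lid k _ c)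
      have : ∀ X, TensorProduct.lid k _ (TensorProduct.map₂ (LinearMap.lsmul k k ∘ₗ H.counit) V.act
          X c) = V.act (TensorProduct.lid k _ (H.counit.rTensor _ X))
            (TensorProduct.lid k _ c) := by
        intro X
        induction X with
        | zero => simp
        | add x y hx hy => simp only [map_add, LinearMap.add_apply, hx, hy]
        | tmul x y =>
        induction c with
        | zero => simp
        | add x y hx hy => simp only [map_add, hx, hy]
        | tmul a b => simp [smul_smul, mul_comm]
      rw [this]
      have : ∀ (t : G) (e : t = p) (ht : 1 * p = t) (x : H.obj t),
          TensorProduct.lid k _ (H.counit.rTensor _ (H.comul ht x)) = H.castObj e x := by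
        rintro t rfl ht x
        exact H.rTensor_counit_comul x
      rw [this])
    (by
      obtain ⟨p, V⟩ := X
      intro r (c : k ⊗[k] V.carrier)
      induction c with
      | zero => simp
      | add x y hx hy => simp only [map_add, hx, hy]
      | tmul a b =>
      rw [YDModule.tensorCoact_tmul _ _ (YDModule.conj_index p r), LinearMap.flip_apply,
        TensorProduct.mk_apply, YDModule.coactMul_tmul_left, H.crossing_map_one]
      simp only [TensorProduct.lid_tmul, map_smul]
      generalize V.coact _ b = B
      induction B with
      | zero => simp
      | add x y hx hy => simp only [map_add, smul_add, hx, hy]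
      | tmul => simp [TensorProduct.smul_tmul'])

/-- The right unit constraint `a ⊗ c ↦ c a`. -/
noncomputable def rightUnitor (X : YD H) : tensorObj X ⟨1, YDModule.unit H⟩ ≅ X :=
  mkIso (mul_one _) (TensorProduct.rid k X.2.carrier)
    (by
      obtain ⟨p, V⟩ := X
      intro x (c : V.carrier ⊗[k] k)
      change TensorProduct.rid k _ (TensorProduct.map₂ V.act (LinearMap.lsmul k k ∘ₗ H.counit)
        (H.comul rfl x) c) = V.act (H.castObj _ x) (TensorProduct.rid k _ c)
      have : ∀ X, TensorProduct.rid k _ (TensorProduct.map₂ V.act (LinearMap.lsmul k k ∘ₗ H.counit)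
          X c) = V.act (TensorProduct.rid k _ (H.counit.lTensor _ X))
            (TensorProduct.rid k _ c) := by
        intro X
        induction X with
        | zero => simp
        | add x y hx hy => simp only [map_add, LinearMap.add_apply, hx, hy]
        | tmul x y =>
        induction c with
        | zero => simp
        | add x y hx hy => simp only [map_add, hx, hy]
        | tmul a b => simp [smul_smul, mul_comm]
      rw [this]
      have : ∀ (t : G) (e : t = p) (ht : p * 1 = t) (x : H.obj t),
          TensorProduct.rid k _ (H.counit.lTensor _ (H.comul ht x)) = H.castObj e x := by
        rintro t rfl ht x
        exact H.lTensor_counit_comul x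
      rw [this])
    (by
      obtain ⟨p, V⟩ := X
      intro r (c : V.carrier ⊗[k] k)
      have i₁ : (1 : G)⁻¹ * r * 1⁻¹⁻¹ = r := by group
      have i₂ : H.crossing 1⁻¹ i₁ = LinearMap.id := by
        have : ∀ (s : G) (hs : s * r * s⁻¹ = r), s = 1 → H.crossing s hs = LinearMap.id := by
          rintro s hs rfl; ext x; exact H.crossing_one _ x
        exact this _ _ inv_one
      induction c with
      | zero => simp
      | add x y hx hy => simp only [map_add, hx, hy]
      | tmul a b =>
      rw [YDModule.tensorCoact_tmul _ _ i₁, LinearMap.flip_apply,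
        TensorProduct.mk_apply]
      simp only [TensorProduct.rid_tmul, map_smul]
      generalize V.coact _ a = B
      induction B with
      | zero => simp
      | add x y hx hy => simp only [map_add, smul_add, TensorProduct.add_tmul, hx, hy]
      | tmul x y => rw [YDModule.coactMul_tmul, i₂]; simp [TensorProduct.smul_tmul'])

noncomputable instance : MonoidalCategoryStruct (YD H) where
  tensorObj := tensorObj
  tensorHom := tensorHom
  whiskerLeft X _ _ f := tensorHom (𝟙 X) f
  whiskerRight f Y := tensorHom f (𝟙 Y)
  tensorUnit := ⟨1, YDModule.unit H⟩
  associator := associator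
  leftUnitor := leftUnitor
  rightUnitor := rightUnitor

theorem toLin_tensorHom' {X X' Y Y' : YD H} (f : X ⟶ X') (g : Y ⟶ Y') :
    toLin (f ⊗ₘ g) = TensorProduct.map (toLin f) (toLin g) := toLin_tensorHom f g

theorem toLin_associator (X Y Z : YD H) :
    toLin (α_ X Y Z).hom =
      (TensorProduct.assoc k X.2.carrier Y.2.carrier Z.2.carrier).toLinearMap :=
  toLin_mkIso_hom ..

theorem toLin_leftUnitor (X : YD H) :
    toLin (λ_ X).hom = (TensorProduct.lid k X.2.carrier).toLinearMap := toLin_mkIso_hom ..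

theorem toLin_rightUnitor (X : YD H) :
    toLin (ρ_ X).hom = (TensorProduct.rid k X.2.carrier).toLinearMap := toLin_mkIso_hom ..

noncomputable instance : MonoidalCategory (YD H) :=
  MonoidalCategory.ofTensorHom
    (id_tensorHom_id := fun X Y => hom_ext (by
      rw [toLin_tensorHom', toLin_id, toLin_id, TensorProduct.map_id]; rfl))
    (id_tensorHom := fun _ _ _ _ => rfl)
    (tensorHom_id := fun _ _ => rfl)
    (tensorHom_comp_tensorHom := fun f₁ f₂ g₁ g₂ => hom_ext (by
      rw [toLin_comp, toLin_tensorHom', toLin_tensorHom', toLin_tensorHom', toLin_comp, toLin_comp,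
        TensorProduct.map_comp]))
    (associator_naturality := fun f₁ f₂ f₃ => hom_ext (by
      simp only [toLin_comp, toLin_associator, toLin_tensorHom']
      exact TensorProduct.ext_threefold fun _ _ _ => rfl))
    (leftUnitor_naturality := fun f => hom_ext (by
      simp only [toLin_comp, toLin_leftUnitor, toLin_tensorHom']
      exact TensorProduct.ext' fun _ _ => (map_smul _ _ _).symm))
    (rightUnitor_naturality := fun f => hom_ext (by
      simp only [toLin_comp, toLin_rightUnitor, toLin_tensorHom']
      exact TensorProduct.ext' fun _ _ => (map_smul _ _ _).symm))
    (pentagon := fun W X Y Z => hom_ext (by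
      simp only [toLin_comp, toLin_associator, toLin_tensorHom']
      exact TensorProduct.ext_fourfold fun _ _ _ _ => rfl))
    (triangle := fun X Y => hom_ext (by
      simp only [toLin_comp, toLin_associator, toLin_tensorHom', toLin_leftUnitor,
        toLin_rightUnitor]
      exact TensorProduct.ext_threefold fun x c y => by
        exact (TensorProduct.smul_tmul c x y).symm))

/-! #### The conjugation functors and the braiding -/

/-- `ˢX`. -/
noncomputable abbrev conjObj (s : G) (X : YD H) : YD H := ⟨s * X.1 * s⁻¹, X.2.conj s⟩

/-- `ˢf`, given by `(ˢf)(ˢa) = ˢ(f(a))`. -/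
noncomputable def conjHom (s : G) {X Y : YD H} (f : X ⟶ Y) : conjObj s X ⟶ conjObj s Y :=
  mkHom (congrArg (s * · * s⁻¹) (deg_eq f)) (toLin f : X.2.carrier →ₗ[k] Y.2.carrier)
    (by
      obtain ⟨f⟩ := f
      intro x a
      exact YDModule.Hom.map_act f _ a)
    (by
      obtain ⟨f⟩ := f
      intro r a
      simp only [YDModule.conjCoact_apply s _ (YDModule.conj_index' s r)]
      simp only [toLin]
      rw [YDModule.Hom.map_coact f]
      simp only [LinearMap.lTensor, LinearMap.rTensor, TensorProduct.map_map, LinearMap.comp_id,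
        LinearMap.id_comp])

theorem toLin_conjHom (s : G) {X Y : YD H} (f : X ⟶ Y) : toLin (conjHom s f) = toLin f :=
  toLin_mkHom ..

/-- The conjugation functor `φ_s = ˢ(·)`. -/
noncomputable def conj (H : CrossedHopfQuasigroup.{u, v, w} k G) (s : G) : YD H ⥤ YD H where
  obj := conjObj s
  map := conjHom s
  map_id _ := rfl
  map_comp f g := by
    obtain ⟨f⟩ := f
    obtain ⟨g⟩ := g
    rfl

/-- The linear map `V ⊗ W → ᵖW ⊗ V`, `a ⊗ b ↦ ᵖ(S(a₍₁,q⁻¹₎) ⋅ b) ⊗ a₍₀₎`, for `V` of degree `p` and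
`W` of degree `q`; recall that `ᵖW = W` as a vector space. -/
noncomputable def braidingMap {p q : G} (V : YDModule H p) (W : YDModule H q) :
    V.carrier ⊗[k] W.carrier →ₗ[k] (W.conj p).carrier ⊗[k] V.carrier :=
  (TensorProduct.comm k V.carrier W.carrier).toLinearMap ∘ₗ
    (TensorProduct.lift (W.act ∘ₗ H.antipode (inv_mul_cancel q))).lTensor V.carrier ∘ₗ
    (TensorProduct.assoc k V.carrier (H.obj q⁻¹) W.carrier).toLinearMap ∘ₗ
    (V.coact q⁻¹).rTensor W.carrier

end YD

end

/-!
The braiding `C_{V,W}(a ⊗ b) = S(a₍₁₎) ⋅ b ⊗ a₍₀₎` has the inverse `b ⊗ a ↦ a₍₀₎ ⊗ a₍₁₎ ⋅ b`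
(`YDModule.unbraid`), which does not involve the antipode. That the two are mutually inverse
(`YDModule.unbraid_braidingMap`, `YDModule.braidingMap_unbraid`) is the only place where the antipode
axioms enter, and only through their instances at `g = 1`, acting on a module, where products are
associative.

Every other property of the braiding is equivalent to one of its inverse, and there it is direct:
linearity is the crossed compatibility condition of `V` (`YDModule.unbraid_act`), colinearity that of
`W` (`YDModule.unbraid_coact`), one hexagon is the definition of the coaction on a tensor product
(`YDModule.unbraid_tensor_left`), the other one is the coassociativity of the coaction
(`YDModule.unbraid_tensor_right`), and compatibility with conjugation holds as `π_{s⁻¹} π_s = id`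
(`YDModule.unbraid_conj`).

In the crossed structure, the equalities of objects relate modules on the same vector space whose
degrees are equal elements of `G` (`YD.obj_ext`), and the resulting `eqToHom`s are the identity on
vectors (`YD.eq_eqToHom_comp`).
-/

/-! ### The crossed structure -/

namespace YD

variable {k : Type u} [Field k] {G : Type v} [Group G] {H : CrossedHopfQuasigroup.{u, v, w} k G}

/-- Two objects whose degrees are equal, possibly only propositionally, and whose underlying vector
spaces are the same are equal as soon as their actions and coactions agree. All the equalities of
objects below have definitionally equal carriers, so that `hc` is `rfl` and the casts along it
reduce. -/
theorem obj_ext {X Y : YD H} (hd : X.1 = Y.1) (hc : X.2.carrier = Y.2.carrier)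
    (ha : HEq X.2.addCommGroup Y.2.addCommGroup) (hm : HEq X.2.module Y.2.module)
    (hact : ∀ x a, cast hc (X.2.act x a) = Y.2.act (H.castObj hd x) (cast hc a))
    (hco : ∀ r a, HEq (X.2.coact r a) (Y.2.coact r (cast hc a))) : X = Y := by
  obtain ⟨p, V⟩ := X
  obtain ⟨q, W⟩ := Y
  obtain rfl : p = q := hd
  cases V with | mk M act h₁ h₂ coact h₃ h₄ h₅ h₆ h₇ =>
  cases W with | mk N act' h₁' h₂' coact' h₃' h₄' h₅' h₆' h₇' =>
  dsimp only at hc ha hm hact hco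
  subst hc
  obtain rfl := eq_of_heq ha
  obtain rfl := eq_of_heq hm
  obtain rfl : act = act' := LinearMap.ext fun x => LinearMap.ext fun a => hact x a
  obtain rfl : coact = coact' := funext fun r => LinearMap.ext fun a => eq_of_heq (hco r a)
  rfl

theorem toLin_eqToHom_comp {X X' Y : YD H} (h : X = X') (f : X' ⟶ Y)
    (hX : X.2.carrier = X'.2.carrier) (a : X.2.carrier) :
    toLin (eqToHom h ≫ f) a = toLin f (cast hX a) := by
  subst h
  simp

/-- The `eqToHom`s in the axioms of a crossed category relate objects with the same vector space, so
they are invisible on underlying linear maps: the casts along `hX` and `hY` are along `rfl` in all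
applications. -/
theorem eq_eqToHom_comp {X X' Y Y' : YD H} {g : X ⟶ Y} {h : X = X'} {f : X' ⟶ Y'} {h' : Y' = Y}
    (hX : X.2.carrier = X'.2.carrier) (hY : Y'.2.carrier = Y.2.carrier)
    (hf : ∀ a, toLin g a = cast hY (toLin f (cast hX a))) : g = eqToHom h ≫ f ≫ eqToHom h' := by
  refine hom_ext (LinearMap.ext fun a => (hf a).trans ?_)
  subst h h'
  simp

theorem crossing_castObj (s : G) {q r t : G} (e : q = r) (h : s * r * s⁻¹ = t) (x : H.obj q) :
    H.crossing s h (H.castObj e x) = H.crossing s (e ▸ h) x := by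
  subst e; rfl

theorem crossing_eq_castObj {s q r : G} (hs : s = 1) (h : s * q * s⁻¹ = r) (e : q = r)
    (x : H.obj q) : H.crossing s h x = H.castObj e x := by
  subst hs e
  exact H.crossing_one h x

/-- `ˢ(V ⊗ W)` and `ˢV ⊗ ˢW` have the same action, as the crossing preserves the comultiplication. -/
theorem conj_tensor_act (s : G) {p q : G} (V : YDModule H p) (W : YDModule H q)
    (h : s * (p * q) * s⁻¹ = s * p * s⁻¹ * (s * q * s⁻¹)) (x : H.obj (s * (p * q) * s⁻¹))
    (c : V.carrier ⊗[k] W.carrier) :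
    ((V.tensor W).conj s).act x c = ((V.conj s).tensor (W.conj s)).act (H.castObj h x) c := by
  change TensorProduct.map₂ V.act W.act (H.comul rfl (H.crossing s⁻¹ _ x)) c =
    TensorProduct.map₂ (V.act ∘ₗ H.crossing s⁻¹ (YDModule.conj_index s p))
      (W.act ∘ₗ H.crossing s⁻¹ (YDModule.conj_index s q)) (H.comul rfl (H.castObj h x)) c
  rw [comul_castObj, ← H.crossing_comul s⁻¹ (YDModule.conj_index s p) (YDModule.conj_index s q) _
    h.symm]
  generalize H.comul _ x = X
  induction X with
  | zero => simp
  | add x y hx hy => simp only [map_add, LinearMap.add_apply, hx, hy]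
  | tmul x y => rfl

/-- `ˢ(V ⊗ W)` and `ˢV ⊗ ˢW` have the same coaction: both twist the coaction on `V` by
`π_s π_{q⁻¹} = π_{(sqs⁻¹)⁻¹} π_s`. -/
theorem conj_tensor_coact (s : G) {p q : G} (V : YDModule H p) (W : YDModule H q) (r : G)
    (c : V.carrier ⊗[k] W.carrier) :
    ((V.tensor W).conj s).coact r c = ((V.conj s).tensor (W.conj s)).coact r c := by
  have h₁ := YDModule.conj_index' s r
  have h₂ := YDModule.conj_index q (s⁻¹ * r * s)
  have h₃ : (s * q * s⁻¹)⁻¹ * (s * (q * (s⁻¹ * r * s) * q⁻¹) * s⁻¹) * (s * q * s⁻¹)⁻¹⁻¹ = r := by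
    group
  induction c with
  | zero => simp
  | add x y hx hy => simp only [map_add, hx, hy]
  | tmul a b =>
  change YDModule.conjCoact s (V.tensor W) r (a ⊗ₜ b) =
    YDModule.tensorCoact (V.conj s) (W.conj s) r (a ⊗ₜ b)
  rw [YDModule.conjCoact_apply s _ h₁, YDModule.tensorCoact_tmul (V.conj s) (W.conj s) h₃]
  change (H.crossing s h₁).lTensor _ (YDModule.tensorCoact V W _ (a ⊗ₜ b)) =
    YDModule.coactMul V.carrier W.carrier _ h₃
      (YDModule.conjCoact s V _ a ⊗ₜ YDModule.conjCoact s W r b)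
  rw [YDModule.tensorCoact_tmul V W h₂, YDModule.conjCoact_apply s V rfl,
    YDModule.conjCoact_apply s W h₁]
  generalize V.coact _ a = A
  generalize W.coact _ b = B
  induction A with
  | zero => simp
  | add x y hx hy => simp only [TensorProduct.add_tmul, map_add, hx, hy]
  | tmul a x =>
  induction B with
  | zero => simp
  | add x y hx hy => simp only [TensorProduct.tmul_add, map_add, hx, hy]
  | tmul b y =>
  simp only [YDModule.coactMul_tmul, LinearMap.lTensor_tmul, H.crossing_map_mul]
  rw [YDModule.crossing_comp (z := s * q⁻¹) rfl h₂ h₁ (by group),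
    YDModule.crossing_comp (z := s * q⁻¹) (by group) rfl h₃ (by group)]

theorem conj_obj_tensor (s : G) (X Y : YD H) :
    (conj H s).obj (X ⊗ Y) = (conj H s).obj X ⊗ (conj H s).obj Y :=
  obj_ext (show s * (X.1 * Y.1) * s⁻¹ = s * X.1 * s⁻¹ * (s * Y.1 * s⁻¹) by group) rfl HEq.rfl
    HEq.rfl (fun x c => conj_tensor_act s X.2 Y.2 _ x c)
    (fun r c => heq_of_eq (conj_tensor_coact s X.2 Y.2 r c))

theorem conj_obj_unit (s : G) : (conj H s).obj (𝟙_ (YD H)) = 𝟙_ (YD H) := by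
  refine obj_ext (show s * 1 * s⁻¹ = 1 by group) rfl HEq.rfl HEq.rfl ?_ ?_
  · have : ∀ (t : G) (e : t = 1) (h : s⁻¹ * t * s⁻¹⁻¹ = 1) (x : H.obj t),
        H.counit (H.crossing s⁻¹ h x) = H.counit (H.castObj e x) := by
      rintro t rfl h x
      exact H.counit_crossing s⁻¹ h x
    intro x (a : k)
    exact congrArg (· • a) (this _ (show s * 1 * s⁻¹ = 1 by group) _ x)
  · intro r (a : k)
    refine heq_of_eq ?_
    change (H.crossing s (YDModule.conj_index' s r)).lTensor k (a ⊗ₜ 1) = a ⊗ₜ 1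
    rw [LinearMap.lTensor_tmul, H.crossing_map_one]

theorem conj_one_obj (X : YD H) : (conj H 1).obj X = X := by
  refine obj_ext (show 1 * X.1 * 1⁻¹ = X.1 by group) rfl HEq.rfl HEq.rfl ?_ ?_
  · intro x a
    exact congrArg (X.2.act · a) (crossing_eq_castObj inv_one _ _ x)
  · intro r a
    refine heq_of_eq ?_
    have h : (1 : G) * r * 1⁻¹ = r := by group
    have e : H.crossing 1 h = LinearMap.id := LinearMap.ext fun x => H.crossing_one h x
    exact (YDModule.conjCoact_apply 1 X.2 h a).trans (by rw [e, LinearMap.lTensor_id]; rfl)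

theorem conj_mul_obj (s t : G) (X : YD H) :
    (conj H (s * t)).obj X = (conj H s).obj ((conj H t).obj X) := by
  refine obj_ext (show s * t * X.1 * (s * t)⁻¹ = s * (t * X.1 * t⁻¹) * s⁻¹ by group) rfl HEq.rfl
    HEq.rfl ?_ ?_
  · intro x a
    exact congrArg (X.2.act · a) ((YDModule.crossing_comp (by group) _ _ _ x).symm.trans
      (congrArg _ (crossing_castObj _ _ _ x).symm))
  · intro r a
    refine heq_of_eq ?_
    have h₁ := YDModule.conj_index' s r
    have h₂ := YDModule.conj_index' t (s⁻¹ * r * s)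
    have h₃ : s * t * (t⁻¹ * (s⁻¹ * r * s) * t) * (s * t)⁻¹ = r := by group
    have e : H.crossing (s * t) h₃ = H.crossing s h₁ ∘ₗ H.crossing t h₂ :=
      LinearMap.ext fun x => (H.crossing_crossing s t h₂ h₁ h₃ x).symm
    refine (YDModule.conjCoact_apply (s * t) X.2 h₃ a).trans ?_
    rw [e, LinearMap.lTensor_comp_apply]
    rfl

theorem conj_map_tensor (s : G) {X X' Y Y' : YD H} (f : X ⟶ X') (g : Y ⟶ Y') :
    (conj H s).map (f ⊗ₘ g) = eqToHom (conj_obj_tensor s X Y) ≫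
      ((conj H s).map f ⊗ₘ (conj H s).map g) ≫ eqToHom (conj_obj_tensor s X' Y').symm := by
  refine eq_eqToHom_comp (by rfl) (by rfl) fun c => ?_
  refine (LinearMap.congr_fun ((toLin_conjHom s _).trans (toLin_tensorHom' f g)) c).trans ?_
  have h : toLin ((conj H s).map f ⊗ₘ (conj H s).map g) =
      TensorProduct.map (toLin f) (toLin g) :=
    (toLin_tensorHom' _ _).trans
      (congrArg₂ TensorProduct.map (toLin_conjHom s f) (toLin_conjHom s g))
  exact (LinearMap.congr_fun h c).symm

theorem conj_map_associator (s : G) (X Y Z : YD H)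
    (h : (conj H s).obj ((X ⊗ Y) ⊗ Z) =
      ((conj H s).obj X ⊗ (conj H s).obj Y) ⊗ (conj H s).obj Z)
    (h' : (conj H s).obj X ⊗ (conj H s).obj Y ⊗ (conj H s).obj Z =
      (conj H s).obj (X ⊗ Y ⊗ Z)) :
    (conj H s).map (α_ X Y Z).hom = eqToHom h ≫
      (α_ ((conj H s).obj X) ((conj H s).obj Y) ((conj H s).obj Z)).hom ≫ eqToHom h' := by
  refine eq_eqToHom_comp (by rfl) (by rfl) fun c => ?_
  refine (LinearMap.congr_fun ((toLin_conjHom s _).trans (toLin_associator X Y Z)) c).trans ?_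
  exact (LinearMap.congr_fun (toLin_associator ((conj H s).obj X) ((conj H s).obj Y)
    ((conj H s).obj Z)) c).symm

theorem conj_map_leftUnitor (s : G) (X : YD H)
    (h : (conj H s).obj (𝟙_ (YD H) ⊗ X) = 𝟙_ (YD H) ⊗ (conj H s).obj X) :
    (conj H s).map (λ_ X).hom = eqToHom h ≫ (λ_ ((conj H s).obj X)).hom := by
  rw [← Category.comp_id (λ_ ((conj H s).obj X)).hom, ← eqToHom_refl _ rfl]
  refine eq_eqToHom_comp (by rfl) (by rfl) fun c => ?_
  refine (LinearMap.congr_fun ((toLin_conjHom s _).trans (toLin_leftUnitor X)) c).trans ?_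
  exact (LinearMap.congr_fun (toLin_leftUnitor ((conj H s).obj X)) c).symm

theorem conj_map_rightUnitor (s : G) (X : YD H)
    (h : (conj H s).obj (X ⊗ 𝟙_ (YD H)) = (conj H s).obj X ⊗ 𝟙_ (YD H)) :
    (conj H s).map (ρ_ X).hom = eqToHom h ≫ (ρ_ ((conj H s).obj X)).hom := by
  rw [← Category.comp_id (ρ_ ((conj H s).obj X)).hom, ← eqToHom_refl _ rfl]
  refine eq_eqToHom_comp (by rfl) (by rfl) fun c => ?_
  refine (LinearMap.congr_fun ((toLin_conjHom s _).trans (toLin_rightUnitor X)) c).trans ?_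
  exact (LinearMap.congr_fun (toLin_rightUnitor ((conj H s).obj X)) c).symm

theorem conj_one : conj H 1 = 𝟭 (YD H) :=
  CategoryTheory.Functor.ext conj_one_obj fun _ _ f =>
    eq_eqToHom_comp (by rfl) (by rfl) fun a => LinearMap.congr_fun (toLin_conjHom 1 f) a

theorem conj_mul (s t : G) : conj H (s * t) = conj H t ⋙ conj H s :=
  CategoryTheory.Functor.ext (conj_mul_obj s t) fun _ _ f =>
    eq_eqToHom_comp (by rfl) (by rfl) fun a =>
      (LinearMap.congr_fun (toLin_conjHom (s * t) f) a).trans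
        (LinearMap.congr_fun ((toLin_conjHom s _).trans (toLin_conjHom t f)) a).symm

theorem isCrossedCategory : IsCrossedCategory (C := YD H) deg (conj H) where
  deg_eq f := deg_eq f
  deg_tensor _ _ := rfl
  conj_strict s :=
    { obj_tensor := conj_obj_tensor s
      obj_unit := conj_obj_unit s
      map_tensor := conj_map_tensor s
      map_associator := fun X Y Z => conj_map_associator s X Y Z _ _
      map_leftUnitor := fun X => conj_map_leftUnitor s X _
      map_rightUnitor := fun X => conj_map_rightUnitor s X _ }
  conj_one := conj_one
  conj_mul := conj_mul
  deg_conj _ _ := rfl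

end YD

/-! ### The inverse braiding on Yetter-Drinfeld modules -/

namespace YDModule

variable {k : Type u} [Field k] {G : Type v} [Group G] {H : CrossedHopfQuasigroup.{u, v, w} k G}
  {p q t : G}

/-- The inverse braiding `ᵖW ⊗ V → V ⊗ W`, `b ⊗ a ↦ a₍₀₎ ⊗ a₍₁,q₎ ⋅ b`, as a linear map; `ᵖW = W` as
a vector space, so that `p` does not enter. -/
noncomputable def unbraid (V : YDModule H p) (W : YDModule H q) :
    W.carrier ⊗[k] V.carrier →ₗ[k] V.carrier ⊗[k] W.carrier :=
  TensorProduct.lift (LinearMap.lcomp k _ (V.coact q) ∘ₗ LinearMap.lTensorHom V.carrier ∘ₗ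
    W.act.flip)

theorem unbraid_tmul (V : YDModule H p) (W : YDModule H q) (b : W.carrier) (a : V.carrier) :
    unbraid V W (b ⊗ₜ a) = (W.act.flip b).lTensor V.carrier (V.coact q a) := rfl

theorem braidingMap_tmul (V : YDModule H p) (W : YDModule H q) (a : V.carrier) (b : W.carrier) :
    YD.braidingMap V W (a ⊗ₜ b) = TensorProduct.comm k V.carrier W.carrier
      ((W.act.flip b ∘ₗ H.antipode (inv_mul_cancel q)).lTensor V.carrier (V.coact q⁻¹ a)) := by
  change TensorProduct.comm k V.carrier W.carrier
    ((TensorProduct.lift (W.act ∘ₗ H.antipode (inv_mul_cancel q))).lTensor V.carrier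
      (TensorProduct.assoc k V.carrier (H.obj q⁻¹) W.carrier (V.coact q⁻¹ a ⊗ₜ b))) = _
  congr 1
  generalize V.coact q⁻¹ a = A
  induction A with
  | zero => simp
  | add x y hx hy => simp only [TensorProduct.add_tmul, map_add, hx, hy]
  | tmul => rfl

/-- `x₍₁,q₎ ⋅ (S(x₍₂,q⁻¹₎) ⋅ b) = ε(x) b`, the antipode axiom `(g x₍₁₎) S(x₍₂₎) = ε(x) g` at `g = 1`
acting on a module. -/
theorem act_antipode_left (W : YDModule H q) (b : W.carrier) (x : H.obj 1) :
    TensorProduct.lift (W.act.compl₂ (W.act.flip b ∘ₗ H.antipode (inv_mul_cancel q)))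
      (H.comul (mul_inv_cancel q) x) = H.counit x • b := by
  have h := H.mul_mul_antipode (inv_mul_cancel q) (mul_inv_cancel q) x 1
  replace h := congrArg (W.act.flip b) h
  simp only [map_smul, LinearMap.flip_apply, W.act_one, LinearMap.id_apply] at h
  rw [← h]
  generalize H.comul _ x = X
  induction X with
  | zero => simp
  | add x y hx hy => simp only [map_add, LinearMap.add_apply, hx, hy]
  | tmul x y => simp [W.act_mul]

/-- `S(x₍₁,q⁻¹₎) ⋅ (x₍₂,q₎ ⋅ b) = ε(x) b`, the antipode axiom `S(x₍₁₎) (x₍₂₎ g) = ε(x) g` at `g = 1`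
acting on a module. -/
theorem act_antipode_right (W : YDModule H q) (b : W.carrier) (x : H.obj 1) :
    TensorProduct.lift ((W.act ∘ₗ H.antipode (inv_mul_cancel q)).compl₂ (W.act.flip b))
      (H.comul (inv_mul_cancel q) x) = H.counit x • b := by
  have h := H.antipode_mul_mul (inv_mul_cancel q) x 1
  replace h := congrArg (W.act.flip b) h
  simp only [map_smul, LinearMap.flip_apply, W.act_one, LinearMap.id_apply] at h
  rw [← h]
  generalize H.comul _ x = X
  induction X with
  | zero => simp
  | add x y hx hy => simp only [map_add, LinearMap.add_apply, hx, hy]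
  | tmul x y => simp [W.act_mul]

theorem lTensor_counit_smul (V : YDModule H p) {N : Type u} [AddCommGroup N] [Module k N]
    (f : H.obj 1 →ₗ[k] N) (b : N) (hf : ∀ x, f x = H.counit x • b) (a : V.carrier) :
    f.lTensor V.carrier (V.coact 1 a) = a ⊗ₜ b := by
  conv_rhs => rw [← V.lTensor_counit_coact a]
  generalize V.coact 1 a = A
  induction A with
  | zero => simp
  | add x y hx hy => simp only [map_add, TensorProduct.add_tmul, hx, hy]
  | tmul => simp [hf, TensorProduct.smul_tmul]

theorem unbraid_braidingMap (V : YDModule H p) (W : YDModule H q)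
    (c : V.carrier ⊗[k] W.carrier) : unbraid V W (YD.braidingMap V W c) = c := by
  induction c with
  | zero => simp
  | add x y hx hy => simp only [map_add, hx, hy]
  | tmul a b =>
  have key : ∀ A : V.carrier ⊗[k] H.obj q⁻¹,
      unbraid V W (TensorProduct.comm k V.carrier W.carrier
        ((W.act.flip b ∘ₗ H.antipode (inv_mul_cancel q)).lTensor V.carrier A)) =
      (TensorProduct.lift
        (W.act.compl₂ (W.act.flip b ∘ₗ H.antipode (inv_mul_cancel q)))).lTensor V.carrier
        (TensorProduct.assoc k V.carrier (H.obj q) (H.obj q⁻¹)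
          ((V.coact q).rTensor (H.obj q⁻¹) A)) := by
    intro A
    induction A with
    | zero => simp
    | add x y hx hy => simp only [map_add, hx, hy]
    | tmul a x =>
    rw [LinearMap.lTensor_tmul, TensorProduct.comm_tmul, unbraid_tmul, LinearMap.rTensor_tmul]
    generalize V.coact q a = A
    induction A with
    | zero => simp
    | add x y hx hy => simp only [map_add, TensorProduct.add_tmul, hx, hy]
    | tmul => simp
  rw [braidingMap_tmul, key, V.coassoc (mul_inv_cancel q), ← LinearMap.lTensor_comp_apply]
  exact V.lTensor_counit_smul _ b (W.act_antipode_left b) a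

theorem braidingMap_unbraid (V : YDModule H p) (W : YDModule H q)
    (c : W.carrier ⊗[k] V.carrier) : YD.braidingMap V W (unbraid V W c) = c := by
  induction c with
  | zero => simp
  | add x y hx hy => simp only [map_add, hx, hy]
  | tmul b a =>
  have key : ∀ A : V.carrier ⊗[k] H.obj q,
      YD.braidingMap V W ((W.act.flip b).lTensor V.carrier A) =
      TensorProduct.comm k V.carrier W.carrier ((TensorProduct.lift
        ((W.act ∘ₗ H.antipode (inv_mul_cancel q)).compl₂ (W.act.flip b))).lTensor V.carrier
        (TensorProduct.assoc k V.carrier (H.obj q⁻¹) (H.obj q)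
          ((V.coact q⁻¹).rTensor (H.obj q) A))) := by
    intro A
    induction A with
    | zero => simp
    | add x y hx hy => simp only [map_add, hx, hy]
    | tmul a x =>
    rw [LinearMap.lTensor_tmul, braidingMap_tmul, LinearMap.rTensor_tmul]
    congr 1
    generalize V.coact q⁻¹ a = A
    induction A with
    | zero => simp
    | add x y hx hy => simp only [map_add, TensorProduct.add_tmul, hx, hy]
    | tmul => simp
  rw [unbraid_tmul, key, V.coassoc (inv_mul_cancel q), ← LinearMap.lTensor_comp_apply,
    V.lTensor_counit_smul _ b (W.act_antipode_right b) a]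
  rfl

/-- The inverse braiding as a linear equivalence, with inverse the braiding map. -/
noncomputable def unbraidEquiv (V : YDModule H p) (W : YDModule H q) :
    W.carrier ⊗[k] V.carrier ≃ₗ[k] V.carrier ⊗[k] W.carrier :=
  LinearEquiv.ofLinearMap (unbraid V W) (YD.braidingMap V W)
    (LinearMap.ext (unbraid_braidingMap V W)) (LinearMap.ext (braidingMap_unbraid V W))

/-- The inverse braiding is linear: by the crossed compatibility condition of `V`,
`(x₍₂₎ ⋅ a)₍₀₎ ⊗ (x₍₂₎ ⋅ a)₍₁₎ π_{p⁻¹}(x₍₁₎) ⋅ b = x₍₁₎ ⋅ a₍₀₎ ⊗ x₍₂₎ a₍₁₎ ⋅ b`. -/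
theorem unbraid_act (V : YDModule H p) (W : YDModule H q) {q' : G}
    (h : p * q = t) (h' : q' * p = t) (hq : p⁻¹ * q' * p⁻¹⁻¹ = q) (x : H.obj t)
    (c : W.carrier ⊗[k] V.carrier) :
    unbraid V W (TensorProduct.map₂ (W.act ∘ₗ H.crossing p⁻¹ hq) V.act (H.comul h' x) c) =
      TensorProduct.map₂ V.act W.act (H.comul h x) (unbraid V W c) := by
  induction c with
  | zero => simp
  | add x y hx hy => simp only [map_add, hx, hy]
  | tmul b a =>
  have k₁ : ∀ X A, TensorProduct.map₂ V.act W.act X ((W.act.flip b).lTensor V.carrier A) =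
      (W.act.flip b).lTensor V.carrier
        (TensorProduct.map₂ V.act (LinearMap.mul k (H.obj q)) X A) := by
    intro X A
    induction X with
    | zero => simp
    | add x y hx hy => simp only [map_add, LinearMap.add_apply, hx, hy]
    | tmul x y =>
    induction A with
    | zero => simp
    | add x y hx hy => simp only [map_add, hx, hy]
    | tmul a z => simp [W.act_mul]
  have k₂ : ∀ X, unbraid V W (TensorProduct.map₂ (W.act ∘ₗ H.crossing p⁻¹ hq) V.act X (b ⊗ₜ a)) =
      (W.act.flip b).lTensor V.carrier (TensorProduct.lift (LinearMap.lTensorHom V.carrier ∘ₗ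
        (LinearMap.mul k (H.obj q)).flip ∘ₗ H.crossing p⁻¹ hq)
        ((V.coact q ∘ₗ V.act.flip a).lTensor (H.obj q') X)) := by
    intro X
    induction X with
    | zero => simp
    | add x y hx hy => simp only [map_add, LinearMap.add_apply, hx, hy]
    | tmul x y =>
    simp only [TensorProduct.map₂_apply_tmul, LinearMap.comp_apply, TensorProduct.map_tmul,
      unbraid_tmul, LinearMap.lTensor_tmul, TensorProduct.lift.tmul, LinearMap.flip_apply,
      LinearMap.coe_lTensorHom]
    generalize V.coact q _ = A
    induction A with
    | zero => simp
    | add x y hx hy => simp only [map_add, hx, hy]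
    | tmul a z => simp [W.act_mul]
  rw [k₂, unbraid_tmul, k₁, V.crossed h h' hq]

/-- The inverse braiding is colinear. By coassociativity of `V`, the coaction of `ᵖW ⊗ V` followed by
the inverse braiding sends `b ⊗ a` to `a₍₀₎ ⊗ x₍₁,q₎ ⋅ b₍₀₎ ⊗ x₍₂,ᵣ₎ b₍₁,ᵣ₎` with `x = a₍₁,qr₎`; the
crossed compatibility condition of `W` turns this into the coaction of `a₍₀₎ ⊗ a₍₁,q₎ ⋅ b`. -/
theorem unbraid_coact (V : YDModule H p) (W : YDModule H q) (r : G)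
    (c : W.carrier ⊗[k] V.carrier) :
    tensorCoact V W r (unbraid V W c) =
      (unbraid V W).rTensor (H.obj r) (tensorCoact (W.conj p) V r c) := by
  induction c with
  | zero => simp
  | add x y hx hy => simp only [map_add, hx, hy]
  | tmul b a =>
  have i₁ := conj_index p r
  have i₂ : p * r * p⁻¹ = p * r * p⁻¹ := rfl
  have i₃ := conj_index q r
  have i₄ : q * r * q⁻¹ * q = q * r := by group
  have k₁ : tensorCoact (W.conj p) V r (b ⊗ₜ a) =
      coactMul W.carrier V.carrier p⁻¹ i₁
        ((H.crossing p i₂).lTensor W.carrier (W.coact r b) ⊗ₜ V.coact r a) := by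
    rw [tensorCoact_tmul (W.conj p) V i₁]
    exact congrArg (fun B => coactMul W.carrier V.carrier p⁻¹ i₁ (B ⊗ₜ V.coact r a))
      (conjCoact_apply p W i₂ b)
  -- `π_{p⁻¹}` from the coaction of the tensor product cancels `π_p` from the coaction of `ᵖW`
  have k₂ : ∀ A B, (unbraid V W).rTensor (H.obj r) (coactMul W.carrier V.carrier p⁻¹ i₁
        ((H.crossing p i₂).lTensor W.carrier B ⊗ₜ A)) =
      (TensorProduct.assoc k _ _ _).symm
        (((TensorProduct.map₂ W.act (LinearMap.mul k (H.obj r))).flip B).lTensor V.carrier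
          (TensorProduct.assoc k _ _ _ ((V.coact q).rTensor (H.obj r) A))) := by
    intro A B
    induction A with
    | zero => simp
    | add x y hx hy => simp only [map_add, TensorProduct.tmul_add, hx, hy]
    | tmul a x =>
    induction B with
    | zero => simp
    | add x y hx hy =>
      simp only [map_add, TensorProduct.add_tmul, LinearMap.lTensor_add, LinearMap.add_apply,
        hx, hy]
    | tmul b y =>
    have e : H.crossing p⁻¹ i₁ (H.crossing p i₂ y) = y := by
      rw [crossing_comp (z := 1) (by group) i₂ i₁ (by group), H.crossing_one]
    rw [LinearMap.lTensor_tmul, coactMul_tmul, LinearMap.rTensor_tmul, LinearMap.rTensor_tmul,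
      unbraid_tmul, e]
    generalize V.coact q a = A
    induction A with
    | zero => simp
    | add x y hx hy => simp only [map_add, TensorProduct.add_tmul, hx, hy]
    | tmul => simp
  -- the other side, written so that the crossed condition of `W` applies under `V ⊗ -`
  have k₃ : ∀ A : V.carrier ⊗[k] H.obj q,
      (TensorProduct.assoc k _ _ _).symm ((TensorProduct.lift
        (LinearMap.lTensorHom W.carrier ∘ₗ (LinearMap.mul k (H.obj r)).flip ∘ₗ
          H.crossing q⁻¹ i₃) ∘ₗ (W.coact r ∘ₗ W.act.flip b).lTensor _).lTensor V.carrier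
            (TensorProduct.assoc k _ _ _ ((V.coact (q * r * q⁻¹)).rTensor (H.obj q) A))) =
        tensorCoact V W r ((W.act.flip b).lTensor V.carrier A) := by
    intro A
    induction A with
    | zero => simp
    | add x y hx hy => simp only [map_add, hx, hy]
    | tmul a x =>
    rw [LinearMap.lTensor_tmul, LinearMap.rTensor_tmul, tensorCoact_tmul V W i₃]
    generalize V.coact _ a = A
    induction A with
    | zero => simp
    | add x y hx hy => simp only [map_add, TensorProduct.add_tmul, hx, hy]
    | tmul a y =>
    simp only [TensorProduct.assoc_tmul, LinearMap.lTensor_tmul, LinearMap.comp_apply,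
      TensorProduct.lift.tmul, LinearMap.coe_lTensorHom]
    generalize W.coact r _ = B
    induction B with
    | zero => simp
    | add x y hx hy => simp only [map_add, TensorProduct.tmul_add, hx, hy]
    | tmul => simp
  have k₄ : (TensorProduct.map₂ W.act (LinearMap.mul k (H.obj r))).flip (W.coact r b) ∘ₗ
      H.comul rfl = (TensorProduct.lift
        (LinearMap.lTensorHom W.carrier ∘ₗ (LinearMap.mul k (H.obj r)).flip ∘ₗ
          H.crossing q⁻¹ i₃) ∘ₗ (W.coact r ∘ₗ W.act.flip b).lTensor _) ∘ₗ H.comul i₄ :=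
    LinearMap.ext fun y => W.crossed rfl i₄ i₃ y b
  rw [unbraid_tmul, ← k₃, V.coassoc i₄, ← LinearMap.lTensor_comp_apply, ← k₄, k₁, k₂,
    V.coassoc rfl, ← LinearMap.lTensor_comp_apply]

/-- Inverse form of the hexagon for `U ⊗ V` and `W`: both sides are
`a₍₀₎ ⊗ b₍₀₎ ⊗ (b₍₁₎ π_{q⁻¹}(a₍₁₎)) ⋅ d`. -/
theorem unbraid_tensor_left (U : YDModule H p) (V : YDModule H q) (W : YDModule H t)
    (c : W.carrier ⊗[k] (U.carrier ⊗[k] V.carrier)) :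
    TensorProduct.assoc k U.carrier V.carrier W.carrier (unbraid (U.tensor V) W c) =
      (unbraid V W).lTensor U.carrier (TensorProduct.assoc k U.carrier W.carrier V.carrier
        ((unbraid U (W.conj q)).rTensor V.carrier
          ((TensorProduct.assoc k W.carrier U.carrier V.carrier).symm c))) := by
  induction c with
  | zero => simp
  | add x y hx hy => simp only [map_add, hx, hy]
  | tmul d c =>
  induction c with
  | zero => simp
  | add x y hx hy => simp only [map_add, TensorProduct.tmul_add, hx, hy]
  | tmul a b =>
  have i₁ := conj_index q t
  rw [TensorProduct.assoc_symm_tmul, LinearMap.rTensor_tmul, unbraid_tmul, unbraid_tmul]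
  change TensorProduct.assoc k U.carrier V.carrier W.carrier
    ((W.act.flip d).lTensor _ (tensorCoact U V t (a ⊗ₜ b))) = _
  rw [tensorCoact_tmul U V i₁]
  generalize U.coact _ a = A
  induction A with
  | zero => simp
  | add x y hx hy => simp only [map_add, TensorProduct.add_tmul, hx, hy]
  | tmul a x =>
  simp only [LinearMap.lTensor_tmul, TensorProduct.assoc_tmul]
  rw [unbraid_tmul]
  generalize V.coact _ b = B
  induction B with
  | zero => simp
  | add x y hx hy => simp only [map_add, TensorProduct.tmul_add, hx, hy]
  | tmul b y => simp [W.act_mul]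

/-- Inverse form of the hexagon for `U` and `V ⊗ W`, which is the coassociativity of `U`. For the
braiding itself it would need the antipode to be anti-comultiplicative. -/
theorem unbraid_tensor_right (U : YDModule H p) (V : YDModule H q) (W : YDModule H t)
    (c : (V.carrier ⊗[k] W.carrier) ⊗[k] U.carrier) :
    unbraid U (V.tensor W) c =
      TensorProduct.assoc k U.carrier V.carrier W.carrier
        ((unbraid U V).rTensor W.carrier
          ((TensorProduct.assoc k V.carrier U.carrier W.carrier).symm
            ((unbraid U W).lTensor V.carrier
              (TensorProduct.assoc k V.carrier W.carrier U.carrier c)))) := by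
  induction c with
  | zero => simp
  | add x y hx hy => simp only [map_add, hx, hy]
  | tmul c a =>
  induction c with
  | zero => simp
  | add x y hx hy => simp only [map_add, TensorProduct.add_tmul, hx, hy]
  | tmul b d =>
  have k₁ : ∀ A, TensorProduct.assoc k U.carrier V.carrier W.carrier
        ((unbraid U V).rTensor W.carrier
          ((TensorProduct.assoc k V.carrier U.carrier W.carrier).symm
            (b ⊗ₜ ((W.act.flip d).lTensor U.carrier A)))) =
      (TensorProduct.map (V.act.flip b) (W.act.flip d)).lTensor U.carrier
        (TensorProduct.assoc k _ _ _ ((U.coact q).rTensor (H.obj t) A)) := by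
    intro A
    induction A with
    | zero => simp
    | add x y hx hy => simp only [map_add, TensorProduct.tmul_add, hx, hy]
    | tmul a x =>
    rw [LinearMap.lTensor_tmul, TensorProduct.assoc_symm_tmul, LinearMap.rTensor_tmul,
      LinearMap.rTensor_tmul, unbraid_tmul]
    generalize U.coact q a = A
    induction A with
    | zero => simp
    | add x y hx hy => simp only [map_add, TensorProduct.add_tmul, hx, hy]
    | tmul => simp
  have k₂ : (V.tensor W).act.flip (b ⊗ₜ d) =
      TensorProduct.map (V.act.flip b) (W.act.flip d) ∘ₗ H.comul rfl := by
    ext x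
    change TensorProduct.map₂ V.act W.act (H.comul rfl x) (b ⊗ₜ d) =
      TensorProduct.map (V.act.flip b) (W.act.flip d) (H.comul rfl x)
    generalize H.comul rfl x = X
    induction X with
    | zero => simp
    | add x y hx hy => simp only [map_add, LinearMap.add_apply, hx, hy]
    | tmul => simp
  rw [TensorProduct.assoc_tmul, LinearMap.lTensor_tmul, unbraid_tmul, unbraid_tmul, k₁,
    U.coassoc rfl, k₂, LinearMap.lTensor_comp_apply]

/-- The coaction of `ˢV` brings in `π_s`, which the `π_{s⁻¹}` in the action of `ˢW` cancels. -/
theorem unbraid_conj (s : G) (V : YDModule H p) (W : YDModule H q)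
    (c : W.carrier ⊗[k] V.carrier) : unbraid (V.conj s) (W.conj s) c = unbraid V W c := by
  induction c with
  | zero => simp
  | add x y hx hy => simp only [map_add, hx, hy]
  | tmul b a =>
  have e : H.crossing s⁻¹ (conj_index s q) ∘ₗ H.crossing s rfl = LinearMap.id :=
    LinearMap.ext fun x => by
      change H.crossing s⁻¹ _ (H.crossing s _ x) = x
      rw [crossing_comp (z := 1) (by group) rfl _ (by group), H.crossing_one]
  rw [unbraid_tmul, unbraid_tmul]
  change ((W.act ∘ₗ H.crossing s⁻¹ (conj_index s q)).flip b).lTensor _ (conjCoact s V _ a) = _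
  rw [conjCoact_apply s V rfl, ← LinearMap.lTensor_comp_apply]
  have : (W.act ∘ₗ H.crossing s⁻¹ (conj_index s q)).flip b ∘ₗ H.crossing s rfl =
      W.act.flip b :=
    LinearMap.ext fun x => congrArg (W.act · b) (LinearMap.congr_fun e x)
  rw [this]

theorem unbraid_naturality {V V' : YDModule H p} {W W' : YDModule H q} (f : V ⟶ V') (g : W ⟶ W')
    (c : W.carrier ⊗[k] V.carrier) :
    unbraid V' W' (TensorProduct.map (Hom.toLin g) (Hom.toLin f) c) =
      TensorProduct.map (Hom.toLin f) (Hom.toLin g) (unbraid V W c) := by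
  induction c with
  | zero => simp
  | add x y hx hy => simp only [map_add, hx, hy]
  | tmul b a =>
  rw [TensorProduct.map_tmul, unbraid_tmul, unbraid_tmul, Hom.map_coact f]
  generalize V.coact q a = A
  induction A with
  | zero => simp
  | add x y hx hy => simp only [map_add, hx, hy]
  | tmul a x => simp [Hom.map_act g]

end YDModule

/-! ### The braiding -/

namespace YD

variable {k : Type u} [Field k] {G : Type v} [Group G] {H : CrossedHopfQuasigroup.{u, v, w} k G}

theorem deg_conj_tensor (X Y : YD H) : ((conj H X.deg).obj Y ⊗ X).deg = (X ⊗ Y).deg :=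
  inv_mul_cancel_right (X.1 * Y.1) X.1

theorem unbraidEquiv_act (X Y : YD H) (x : H.obj ((conj H X.deg).obj Y ⊗ X).1)
    (c : ((conj H X.deg).obj Y ⊗ X).2.carrier) :
    X.2.unbraidEquiv Y.2 (((conj H X.deg).obj Y ⊗ X).2.act x c) =
      (X ⊗ Y).2.act (H.castObj (deg_conj_tensor X Y) x) (X.2.unbraidEquiv Y.2 c) :=
  (X.2.unbraid_act Y.2 (deg_conj_tensor X Y).symm rfl (YDModule.conj_index X.1 Y.1) x c).trans
    (LinearMap.congr_fun (congrArg (TensorProduct.map₂ X.2.act Y.2.act)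
      (comul_castObj rfl _ x)) _).symm

/-- The braiding isomorphism `C_{X,Y} : X ⊗ Y ≅ ˣY ⊗ X`, constructed as the inverse of
`b ⊗ a ↦ a₍₀₎ ⊗ a₍₁₎ ⋅ b`. -/
noncomputable def braiding (X Y : YD H) : X ⊗ Y ≅ (conj H X.deg).obj Y ⊗ X :=
  (mkIso (deg_conj_tensor X Y) (X.2.unbraidEquiv Y.2) (unbraidEquiv_act X Y)
    (X.2.unbraid_coact Y.2)).symm

theorem toLin_braiding_hom (X Y : YD H) : toLin (braiding X Y).hom = braidingMap X.2 Y.2 :=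
  toLin_mkIso_inv (deg_conj_tensor X Y) (X.2.unbraidEquiv Y.2) (unbraidEquiv_act X Y)
    (X.2.unbraid_coact Y.2)

theorem toLin_braiding_inv (X Y : YD H) : toLin (braiding X Y).inv = X.2.unbraid Y.2 :=
  toLin_mkIso_hom (deg_conj_tensor X Y) (X.2.unbraidEquiv Y.2) (unbraidEquiv_act X Y)
    (X.2.unbraid_coact Y.2)

theorem toLin_associator_inv (X Y Z : YD H) :
    toLin (α_ X Y Z).inv =
      (TensorProduct.assoc k X.2.carrier Y.2.carrier Z.2.carrier).symm.toLinearMap :=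
  toLin_mkIso_inv ..

theorem toLin_whiskerLeft (X : YD H) {Y Z : YD H} (f : Y ⟶ Z) :
    toLin (X ◁ f) = (toLin f).lTensor X.2.carrier :=
  toLin_tensorHom (𝟙 X) f

theorem toLin_whiskerRight {Y Z : YD H} (f : Y ⟶ Z) (X : YD H) :
    toLin (f ▷ X) = (toLin f).rTensor X.2.carrier :=
  toLin_tensorHom f (𝟙 X)

theorem braiding_naturality {U U' V V' : YD H} (f : U ⟶ U') (g : V ⟶ V')
    (h : (conj H U.deg).obj V' ⊗ U' = (conj H U'.deg).obj V' ⊗ U') :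
    (braiding U V).hom ≫ ((conj H U.deg).map g ⊗ₘ f) ≫ eqToHom h =
      (f ⊗ₘ g) ≫ (braiding U' V').hom := by
  rw [← Iso.eq_inv_comp, ← Category.assoc, ← Iso.comp_inv_eq, Category.assoc]
  -- destructuring identifies the degrees, which makes the `eqToHom` an identity
  obtain ⟨f⟩ := f
  obtain ⟨g⟩ := g
  rw [eqToHom_refl, Category.id_comp]
  refine hom_ext (LinearMap.ext fun c => ?_)
  rw [toLin_comp, toLin_comp, toLin_braiding_inv, toLin_braiding_inv]
  exact YDModule.unbraid_naturality f g c

theorem braiding_tensor_left (U V W : YD H)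
    (h : (conj H U.deg).obj ((conj H V.deg).obj W) ⊗ (U ⊗ V) =
      (conj H (deg (U ⊗ V))).obj W ⊗ (U ⊗ V)) :
    (braiding (U ⊗ V) W).hom =
      (α_ U V W).hom ≫ U ◁ (braiding V W).hom ≫ (α_ U ((conj H V.deg).obj W) V).inv ≫
        (braiding U ((conj H V.deg).obj W)).hom ▷ V ≫
          (α_ ((conj H U.deg).obj ((conj H V.deg).obj W)) U V).hom ≫ eqToHom h := by
  -- an equality of isomorphisms may be checked on the inverses
  suffices braiding (U ⊗ V) W = α_ U V W ≪≫ whiskerLeftIso U (braiding V W) ≪≫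
      (α_ U ((conj H V.deg).obj W) V).symm ≪≫
        whiskerRightIso (braiding U ((conj H V.deg).obj W)) V ≪≫
          α_ ((conj H U.deg).obj ((conj H V.deg).obj W)) U V ≪≫ eqToIso h from
    congrArg Iso.hom this
  refine Iso.ext_inv ?_
  simp only [Iso.trans_inv, Iso.symm_inv, whiskerLeftIso_inv, whiskerRightIso_inv, eqToIso.inv,
    Category.assoc]
  rw [← Category.assoc, ← Category.assoc, ← Category.assoc, ← Category.assoc, Iso.eq_comp_inv]
  simp only [Category.assoc]
  refine hom_ext (LinearMap.ext fun c => ?_)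
  refine Eq.trans ?_ (toLin_eqToHom_comp _ _ (by rfl) c).symm
  simp only [toLin_comp, toLin_braiding_inv, toLin_associator, toLin_associator_inv,
    toLin_whiskerLeft, toLin_whiskerRight]
  exact YDModule.unbraid_tensor_left U.2 V.2 W.2 c

theorem braiding_tensor_right (U V W : YD H)
    (h : ((conj H U.deg).obj V ⊗ (conj H U.deg).obj W) ⊗ U = (conj H U.deg).obj (V ⊗ W) ⊗ U) :
    (braiding U (V ⊗ W)).hom =
      (α_ U V W).inv ≫ (braiding U V).hom ▷ W ≫ (α_ ((conj H U.deg).obj V) U W).hom ≫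
        (conj H U.deg).obj V ◁ (braiding U W).hom ≫
          (α_ ((conj H U.deg).obj V) ((conj H U.deg).obj W) U).inv ≫ eqToHom h := by
  -- an equality of isomorphisms may be checked on the inverses
  suffices braiding U (V ⊗ W) = (α_ U V W).symm ≪≫ whiskerRightIso (braiding U V) W ≪≫
      α_ ((conj H U.deg).obj V) U W ≪≫ whiskerLeftIso ((conj H U.deg).obj V) (braiding U W) ≪≫
        (α_ ((conj H U.deg).obj V) ((conj H U.deg).obj W) U).symm ≪≫ eqToIso h from
    congrArg Iso.hom this
  refine Iso.ext_inv ?_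
  simp only [Iso.trans_inv, Iso.symm_inv, whiskerLeftIso_inv, whiskerRightIso_inv, eqToIso.inv,
    Category.assoc]
  refine hom_ext (LinearMap.ext fun c => ?_)
  refine Eq.trans ?_ (toLin_eqToHom_comp _ _ (by rfl) c).symm
  simp only [toLin_comp, toLin_braiding_inv, toLin_associator, toLin_associator_inv,
    toLin_whiskerLeft, toLin_whiskerRight]
  exact YDModule.unbraid_tensor_right U.2 V.2 W.2 c

theorem conj_map_braiding (s : G) (U V : YD H)
    (h : (conj H s).obj (U ⊗ V) = (conj H s).obj U ⊗ (conj H s).obj V)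
    (h' : (conj H (deg ((conj H s).obj U))).obj ((conj H s).obj V) ⊗ (conj H s).obj U =
      (conj H s).obj ((conj H U.deg).obj V ⊗ U)) :
    (conj H s).map (braiding U V).hom =
      eqToHom h ≫ (braiding ((conj H s).obj U) ((conj H s).obj V)).hom ≫ eqToHom h' := by
  suffices (conj H s).mapIso (braiding U V) =
      eqToIso h ≪≫ braiding ((conj H s).obj U) ((conj H s).obj V) ≪≫ eqToIso h' from
    congrArg Iso.hom this
  refine Iso.ext_inv ?_
  simp only [Iso.trans_inv, Functor.mapIso_inv, eqToIso.inv, Category.assoc]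
  refine eq_eqToHom_comp (by rfl) (by rfl) fun c => ?_
  refine (LinearMap.congr_fun ((toLin_conjHom s _).trans (toLin_braiding_inv U V)) c).trans ?_
  refine (YDModule.unbraid_conj s U.2 V.2 c).symm.trans ?_
  exact (LinearMap.congr_fun
    (toLin_braiding_inv ((conj H s).obj U) ((conj H s).obj V)) c).symm

end YD

theorem theorem4p10 {k : Type u} [Field k] {G : Type v} [Group G]
    (H : CrossedHopfQuasigroup.{u, v, w} k G) (hS : H.BijectiveAntipode) :
    ∃ (hC : IsCrossedCategory (C := YD H) YD.deg (YD.conj H))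
      (c : ∀ X Y : YD H, X ⊗ Y ≅ (YD.conj H X.deg).obj Y ⊗ X),
      IsCrossedBraiding hC c ∧
        ∀ X Y : YD H, YD.toLin (c X Y).hom = YD.braidingMap X.2 Y.2 :=
  ⟨YD.isCrossedCategory, YD.braiding,
    { naturality := fun f g => YD.braiding_naturality f g _
      tensor_left := fun U V W => YD.braiding_tensor_left U V W _
      tensor_right := fun U V W => YD.braiding_tensor_right U V W _
      conj_map := fun s U V => YD.conj_map_braiding s U V _ _ },
    YD.toLin_braiding_hom⟩
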